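/- Let $(M,g)$ be a smooth Riemannian manifold (Hausdorff, without boundary) of dimension $n\ge 1$ with Levi-Civita connection $\nabla^g$, and let $\nabla$ be a smooth metric connection on $M$ whose torsion is totally skew-symmetric, i.e. $T(X,Y,Z)=g(\nabla_XY-\nabla_YX-[X,Y],Z)$ is a 3-form. Conventions. Let $e_1,\dots,e_n$ denote an orthonormal basis of a tangent space; repeated indices are summed from $1$ to $n$. Put $R(X,Y)Z=[\nabla_X,\nabla_Y]Z-\nabla_{[X,Y]}Z$, $R(X,Y,Z,V)=g(R(X,Y)Z,V)$, $Ric(X,Y)=R(e_i,X,Y,e_i)$, $Scal=Ric(e_i,e_i)$, and let $Scal^g$ be the scalar curvature of $\nabla^g$. Put $T^2_{ij}=T_{iab}T_{jab}$, $\|T\|^2=T_{abc}T_{abc}$, $(\delta T)_{ij}=-\nabla^g_sT_{sij}$, and define the 1-forms $\theta_j=(\delta T)_{ab}T_{jab}$ and $\Theta_j=T_{abc}(dT)_{jabc}$. We say that $T$ is harmonic if $dT=0$ and $\delta T=0$, and that $R\in S^2\Lambda^2$ if $R(X,Y,Z,V)=R(Z,V,X,Y)$ for all $X,Y,Z,V$.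 Suppose that $\nabla$ is $\nabla$-Einstein: there is a function $\lambda$ on $M$ with $\frac12\big(Ric(X,Y)+Ric(Y,X)\big)=\lambda\, g(X,Y)$ for all $X,Y$. a) The following identity holds on $M$: $$\frac{n-2}{n}\,d(Scal)_j-\frac12\nabla^g_sT^2_{sj}+\frac14\, d(\|T\|^2)_j=0 .$$ Suppose in b) and c) that $M$ is connected and $n\neq 2$. b) If $3\theta+\Theta=0$, then there is a constant $C$ such that $$Scal=-\frac{n}{6(n-2)}\|T\|^2+C\quad\text{and}\quad Scal^g=Scal+\frac14\|T\|^2=\frac{n-6}{12(n-2)}\|T\|^2+C .$$ In particular, this holds if $T$ is harmonic. c) If $R\in S^2\Lambda^2$, then there is a constant $B$ such that $$Scal=-\frac{n}{2(n-2)}\|T\|^2+B\quad\text{and}\quad Scal^g=-\frac{n+2}{4(n-2)}\|T\|^2+B .$$ In particular, if in b) or in c) $Scal$ is constant, then $\|T\|^2$ is constant. -/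

import Mathlib

open scoped Manifold ContDiff Bundle

namespace SkewTorsion

noncomputable section

variable {n : ℕ} {M : Type*} [TopologicalSpace M] [ChartedSpace (EuclideanSpace ℝ (Fin n)) M]

/-- An affine connection `∇` on `M`. In Mathlib's argument order `nabla Y x u` is `(∇_u Y)(x)`. -/
abbrev Connection (n : ℕ) (M : Type*) [TopologicalSpace M]
    [ChartedSpace (EuclideanSpace ℝ (Fin n)) M] [IsManifold (𝓡 n) ∞ M] :=
  CovariantDerivative (𝓡 n) (EuclideanSpace ℝ (Fin n)) (fun x : M => TangentSpace (𝓡 n) x)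

/-- A smooth vector field near `x` with value `u` at `x` (constant coefficients in the preferred
chart at `x`). All expressions below in which it occurs are tensorial, so that they do not depend on
the choice of the extension. -/
abbrev ext {x : M} (u : TangentSpace (𝓡 n) x) [IsManifold (𝓡 n) ∞ M] :
    Π y : M, TangentSpace (𝓡 n) y :=
  FiberBundle.extend (EuclideanSpace ℝ (Fin n)) u

section NoMetric

variable [IsManifold (𝓡 n) ∞ M]

/-- `R(X, Y) Z = ∇_X ∇_Y Z - ∇_Y ∇_X Z - ∇_[X,Y] Z` for vector fields. -/
def curvatureField (nabla : Connection n M) (X Y Z : Π y : M, TangentSpace (𝓡 n) y) (x : M) :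
    TangentSpace (𝓡 n) x :=
  nabla (fun y => nabla Z y (Y y)) x (X x) - nabla (fun y => nabla Z y (X y)) x (Y x)
    - nabla Z x (VectorField.mlieBracket (𝓡 n) X Y x)

/-- The curvature endomorphism `R(u, v) w` for tangent vectors at `x`. -/
def curvature (nabla : Connection n M) (x : M) (u v w : TangentSpace (𝓡 n) x) :
    TangentSpace (𝓡 n) x :=
  curvatureField nabla (ext u) (ext v) (ext w) x

/-- The covariant derivative `(∇_z B)(u, v)` of a covariant 2-tensor field. -/
def covDeriv₂ (nabla : Connection n M)
    (B : Π y : M, TangentSpace (𝓡 n) y → TangentSpace (𝓡 n) y → ℝ)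
    (x : M) (z u v : TangentSpace (𝓡 n) x) : ℝ :=
  mvfderiv (𝓡 n) (fun y => B y (ext u y) (ext v y)) x z
    - B x (nabla (ext u) x z) v - B x u (nabla (ext v) x z)

/-- The covariant derivative `(∇_z A)(u, v, w)` of a covariant 3-tensor field. -/
def covDeriv₃ (nabla : Connection n M)
    (A : Π y : M, TangentSpace (𝓡 n) y → TangentSpace (𝓡 n) y → TangentSpace (𝓡 n) y → ℝ)
    (x : M) (z u v w : TangentSpace (𝓡 n) x) : ℝ :=
  mvfderiv (𝓡 n) (fun y => A y (ext u y) (ext v y) (ext w y)) x z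
    - A x (nabla (ext u) x z) v w - A x u (nabla (ext v) x z) w - A x u v (nabla (ext w) x z)

/-- The exterior derivative of a 3-form `A` by the invariant formula
`dA(X₀,…,X₃) = ∑ᵢ (-1)ⁱ Xᵢ(A(…,X̂ᵢ,…)) + ∑_{i<j} (-1)^{i+j} A([Xᵢ,Xⱼ],…,X̂ᵢ,…,X̂ⱼ,…)`. -/
def extDeriv₃
    (A : Π y : M, TangentSpace (𝓡 n) y → TangentSpace (𝓡 n) y → TangentSpace (𝓡 n) y → ℝ)
    (x : M) (u₀ u₁ u₂ u₃ : TangentSpace (𝓡 n) x) : ℝ :=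
  mvfderiv (𝓡 n) (fun y => A y (ext u₁ y) (ext u₂ y) (ext u₃ y)) x u₀
    - mvfderiv (𝓡 n) (fun y => A y (ext u₀ y) (ext u₂ y) (ext u₃ y)) x u₁
    + mvfderiv (𝓡 n) (fun y => A y (ext u₀ y) (ext u₁ y) (ext u₃ y)) x u₂
    - mvfderiv (𝓡 n) (fun y => A y (ext u₀ y) (ext u₁ y) (ext u₂ y)) x u₃
    - A x (VectorField.mlieBracket (𝓡 n) (ext u₀) (ext u₁) x) u₂ u₃
    + A x (VectorField.mlieBracket (𝓡 n) (ext u₀) (ext u₂) x) u₁ u₃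
    - A x (VectorField.mlieBracket (𝓡 n) (ext u₀) (ext u₃) x) u₁ u₂
    - A x (VectorField.mlieBracket (𝓡 n) (ext u₁) (ext u₂) x) u₀ u₃
    + A x (VectorField.mlieBracket (𝓡 n) (ext u₁) (ext u₃) x) u₀ u₂
    - A x (VectorField.mlieBracket (𝓡 n) (ext u₂) (ext u₃) x) u₀ u₁

end NoMetric

theorem finrank_tangentSpace (x : M) : Module.finrank ℝ (TangentSpace (𝓡 n) x) = n := by
  change Module.finrank ℝ (EuclideanSpace ℝ (Fin n)) = n
  simp

instance finiteDimensional_tangentSpace (x : M) :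
    FiniteDimensional ℝ (TangentSpace (𝓡 n) x) :=
  inferInstanceAs (FiniteDimensional ℝ (EuclideanSpace ℝ (Fin n)))

variable [Bundle.RiemannianBundle (fun x : M => TangentSpace (𝓡 n) x)]

/-- An orthonormal basis `e₁, …, eₙ` of the tangent space at `x`. The traces below do not depend on
which one is taken, and nothing is assumed about the dependence on `x`. -/
def frame (x : M) : OrthonormalBasis (Fin n) ℝ (TangentSpace (𝓡 n) x) :=
  (stdOrthonormalBasis ℝ (TangentSpace (𝓡 n) x)).reindex (finCongr (finrank_tangentSpace x))

/-! ### Algebra of a covariant 3-tensor field -/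

/-- `T²(u, v) = ∑ T(u, e_a, e_b) T(v, e_a, e_b)`. -/
def tensorSq
    (T : Π y : M, TangentSpace (𝓡 n) y → TangentSpace (𝓡 n) y → TangentSpace (𝓡 n) y → ℝ)
    (x : M) (u v : TangentSpace (𝓡 n) x) : ℝ :=
  ∑ a, ∑ b, T x u (frame x a) (frame x b) * T x v (frame x a) (frame x b)

/-- `‖T‖² = ∑ T(e_a, e_b, e_c)²`, the sum over all triples of indices. -/
def normSq
    (T : Π y : M, TangentSpace (𝓡 n) y → TangentSpace (𝓡 n) y → TangentSpace (𝓡 n) y → ℝ)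
    (x : M) : ℝ :=
  ∑ a, ∑ b, ∑ c, T x (frame x a) (frame x b) (frame x c) ^ 2

variable [IsManifold (𝓡 n) ∞ M]

/-! ### Curvatures of a connection -/

/-- `R(X, Y, Z, V) = g(R(X, Y) Z, V)`. -/
def curvature₄ (nabla : Connection n M) (x : M) (X Y Z V : TangentSpace (𝓡 n) x) : ℝ :=
  inner ℝ (curvature nabla x X Y Z) V

/-- `Ric(X, Y) = ∑ R(e_i, X, Y, e_i)`. -/
def ricci (nabla : Connection n M) (x : M) (X Y : TangentSpace (𝓡 n) x) : ℝ :=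
  ∑ i, curvature₄ nabla x (frame x i) X Y (frame x i)

/-- `Scal = ∑ Ric(e_i, e_i)`. -/
def scal (nabla : Connection n M) (x : M) : ℝ :=
  ∑ i, ricci nabla x (frame x i) (frame x i)

/-- The symmetric part of the Ricci tensor is a scalar multiple of the metric; the factor may be a
function on `M`. -/
def IsNablaEinstein (nabla : Connection n M) : Prop :=
  ∃ lam : M → ℝ, ∀ (x : M) (X Y : TangentSpace (𝓡 n) x),
    (ricci nabla x X Y + ricci nabla x Y X) / 2 = lam x * inner ℝ X Y

/-- `R ∈ S²Λ²`, that is, `R(X, Y, Z, V) = R(Z, V, X, Y)`. -/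
def CurvaturePairSymmetric (nabla : Connection n M) : Prop :=
  ∀ (x : M) (X Y Z V : TangentSpace (𝓡 n) x),
    curvature₄ nabla x X Y Z V = curvature₄ nabla x Z V X Y

/-! ### Torsion, the Levi-Civita connection, codifferential and torsion 1-forms -/

/-- `T(u, v, w) = g(T(u, v), w)`, where `T(X, Y) = ∇_X Y - ∇_Y X - [X, Y]`. -/
def torsionForm (nabla : Connection n M) (x : M) (u v w : TangentSpace (𝓡 n) x) : ℝ :=
  inner ℝ (nabla.torsion x u v) w

/-- The divergence `(div B)(v) = ∑ (∇_{e_s} B)(e_s, v)` of a covariant 2-tensor field. -/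
def divergence₂ (nabla : Connection n M)
    (B : Π y : M, TangentSpace (𝓡 n) y → TangentSpace (𝓡 n) y → ℝ)
    (x : M) (v : TangentSpace (𝓡 n) x) : ℝ :=
  ∑ s, covDeriv₂ nabla B x (frame x s) (frame x s) v

/-- The codifferential `δT(u, v) = -∑ (∇ᵍ_{e_s} T)(e_s, u, v)` of a 3-form, where `nablaG` is the
Levi-Civita connection `∇ᵍ`. -/
def codiff₃ (nablaG : Connection n M)
    (T : Π y : M, TangentSpace (𝓡 n) y → TangentSpace (𝓡 n) y → TangentSpace (𝓡 n) y → ℝ)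
    (x : M) (u v : TangentSpace (𝓡 n) x) : ℝ :=
  -∑ s, covDeriv₃ nablaG T x (frame x s) (frame x s) u v

/-- `θ(v) = ∑ δT(e_a, e_b) T(v, e_a, e_b)`. -/
def smallTheta (nablaG : Connection n M)
    (T : Π y : M, TangentSpace (𝓡 n) y → TangentSpace (𝓡 n) y → TangentSpace (𝓡 n) y → ℝ)
    (x : M) (v : TangentSpace (𝓡 n) x) : ℝ :=
  ∑ a, ∑ b, codiff₃ nablaG T x (frame x a) (frame x b) * T x v (frame x a) (frame x b)

/-- `Θ(v) = ∑ T(e_a, e_b, e_c) dT(v, e_a, e_b, e_c)`. -/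
def bigTheta
    (T : Π y : M, TangentSpace (𝓡 n) y → TangentSpace (𝓡 n) y → TangentSpace (𝓡 n) y → ℝ)
    (x : M) (v : TangentSpace (𝓡 n) x) : ℝ :=
  ∑ a, ∑ b, ∑ c, T x (frame x a) (frame x b) (frame x c) *
    extDeriv₃ T x v (frame x a) (frame x b) (frame x c)

/-- The 3-form `T` is harmonic: `dT = 0` and `δT = 0`. -/
def IsHarmonic₃ (nablaG : Connection n M)
    (T : Π y : M, TangentSpace (𝓡 n) y → TangentSpace (𝓡 n) y → TangentSpace (𝓡 n) y → ℝ) :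
    Prop :=
  (∀ (x : M) (u₀ u₁ u₂ u₃ : TangentSpace (𝓡 n) x), extDeriv₃ T x u₀ u₁ u₂ u₃ = 0) ∧
    ∀ (x : M) (u v : TangentSpace (𝓡 n) x), codiff₃ nablaG T x u v = 0

variable
  [IsContMDiffRiemannianBundle (𝓡 n) ∞ (EuclideanSpace ℝ (Fin n))
    (fun x : M => TangentSpace (𝓡 n) x)]

instance isContMDiffRiemannianBundle_one :
    IsContMDiffRiemannianBundle (𝓡 n) 1 (EuclideanSpace ℝ (Fin n))
      (fun x : M => TangentSpace (𝓡 n) x) :=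
  IsContMDiffRiemannianBundle.of_le (n := ∞) (by norm_cast)

/-- A smooth metric connection whose torsion is totally skew-symmetric. -/
structure IsMetricWithSkewTorsion (nabla : Connection n M) : Prop where
  smooth : CovariantDerivative.ContMDiffCovariantDerivative nabla ∞
  metric : nabla.IsMetricCompatible
  skew₁₂ : ∀ (x : M) (u v w : TangentSpace (𝓡 n) x),
    torsionForm nabla x u v w = -torsionForm nabla x v u w
  skew₂₃ : ∀ (x : M) (u v w : TangentSpace (𝓡 n) x),
    torsionForm nabla x u v w = -torsionForm nabla x u w v

/-- The Levi-Civita connection: metric and torsion-free. -/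
structure IsLeviCivita (nablaG : Connection n M) : Prop where
  metric : nablaG.IsMetricCompatible
  torsion_eq_zero : nablaG.torsion = 0

end

end SkewTorsion

/-! Write `∇ = ∇ᵍ + T/2`. The curvature of `∇` is that of `∇ᵍ` plus terms linear in `∇ᵍT` plus terms
quadratic in `T`. In the symmetric part of the Ricci tensor the linear terms disappear and the
quadratic ones add up to `-T²/4` (`ChartModel.ric_symm_part`). Hence the Einstein condition says
`Ricᵍ = (Scal/n) g + T²/4`, and a trace gives `Scalᵍ = Scal + ‖T‖²/4`. Inserting both in the
contracted second Bianchi identity `d Scalᵍ = 2 div Ricᵍ` (`ChartModel.contracted_bianchi`) is part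
a).

Parts b) and c) then only need `div T²`. By the Leibniz rule it is `-θ + X` with `X_w = ∑ T(s,a,b)
(∇ᵍ_s T)(w,a,b)`. Contracting `dT`, the alternation of `∇ᵍT`, with `T` gives `Θ = d‖T‖²/2 - 3X`, so
`div T² = -θ - Θ/3 + d‖T‖²/6` (`ChartModel.div_sq`). If `R` is pair symmetric, then `∇ᵍT` is totally
skew (`ChartModel.cov_T_swap_of_pair_symm`), so `δT = 0` and `X = -d‖T‖²/2`. In both cases a)
becomes `d Scal = -k d‖T‖²` with a constant `k`, and connectedness integrates it.

The tensor calculus is done in a vector space, for a metric `g`, symmetric Christoffel symbols `S`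
and a torsion `τ` (`ChartModel`). The orthonormal frames may depend on the point without any
regularity. A trace is nevertheless differentiable, because it can be rewritten through the inverse
Gram matrix of a fixed basis (`trace_differentiable`). The manifold enters by reading connection,
curvature, torsion and metric in the chart at `x` (`coord_connection`, `coord_curvature`,
`chartModel`). The Christoffel symbols of `∇ᵍ` are identified with the symmetric part of those of
`∇` (`chr_leviCivita`). -/

namespace SkewTorsion

set_option maxSynthPendingDepth 3

/-! ### Traces in orthonormal frames without regularity -/

section Frames

variable {n : ℕ} {E : Type*} [NormedAddCommGroup E] [NormedSpace ℝ E]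

/-- `b` is orthonormal for the bilinear form `G`. -/
def IsOrthonormalFor (G : E →L[ℝ] E →L[ℝ] ℝ) (b : Fin n → E) : Prop :=
  ∀ i j, G (b i) (b j) = if i = j then 1 else 0

variable [FiniteDimensional ℝ E]

/-- Pairing with `b i` isolates the `i`-th coefficient, so the `n` vectors are independent and form
a basis. Neither symmetry nor positivity of `G` enters. -/
theorem IsOrthonormalFor.expand {G : E →L[ℝ] E →L[ℝ] ℝ} {b : Fin n → E}
    (hb : IsOrthonormalFor G b) (hn : Module.finrank ℝ E = n) (u : E) :
    u = ∑ i, G u (b i) • b i := by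
  have hli : LinearIndependent ℝ b := by
    rw [Fintype.linearIndependent_iff]
    intro c hc i
    have := congrArg (fun u => G u (b i)) hc
    simpa [hb _ _] using this
  have hspan : ⊤ ≤ Submodule.span ℝ (Set.range b) :=
    (hli.span_eq_top_of_card_eq_finrank' (by simp [hn])).ge
  have hrepr : ∀ i, (Module.Basis.mk hli hspan).repr u i = G u (b i) := by
    intro i
    conv_rhs => rw [← (Module.Basis.mk hli hspan).sum_repr u]
    simp [hb _ _]
  conv_lhs => rw [← (Module.Basis.mk hli hspan).sum_repr u]
  exact Finset.sum_congr rfl fun i _ => by rw [hrepr i, Module.Basis.mk_apply]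

/-- The trace of a bilinear map with respect to an orthonormal basis, in terms of another basis. -/
theorem IsOrthonormalFor.sum_eq_inv {G G' : E →L[ℝ] E →L[ℝ] ℝ} {b c : Fin n → E}
    (hb : IsOrthonormalFor G b) (hc : IsOrthonormalFor G' c) (hn : Module.finrank ℝ E = n)
    {A : E → E → ℝ} (hA : IsBilinearMap ℝ A) :
    ∑ a, A (c a) (c a) = ∑ i, ∑ j,
      (Matrix.of fun i j => G' (b i) (b j))⁻¹ i j * A (b i) (b j) := by
  set P : Matrix (Fin n) (Fin n) ℝ := Matrix.of fun a i => G (c a) (b i) with hP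
  set Q : Matrix (Fin n) (Fin n) ℝ := Matrix.of fun i j => G' (b i) (b j) with hQ
  have hPe : ∀ a, c a = ∑ i, P a i • b i := fun a => hb.expand hn (c a)
  -- With `c = P b`, orthonormality of `c` reads `P Q Pᵀ = 1`. Hence `Q⁻¹ = Pᵀ P`, and the frame `c`
  -- drops out of the trace.
  have h1 : P * (Q * P.transpose) = 1 := by
    ext a a'
    have := hc a a'
    rw [hPe a, hPe a'] at this
    rw [Matrix.one_apply, ← this]
    simp only [map_sum, map_smul, sum_apply, smul_apply, smul_eq_mul, Matrix.mul_apply, hQ,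
      Matrix.transpose_apply, Matrix.of_apply, Finset.mul_sum]
    rw [Finset.sum_comm]
    exact Finset.sum_congr rfl fun i _ => Finset.sum_congr rfl fun j _ => by ring
  have h2 : Q * (P.transpose * P) = 1 := by
    rw [← Matrix.mul_assoc]; exact mul_eq_one_comm.mp h1
  rw [Matrix.inv_eq_right_inv h2]
  have hsum : ∀ a, A (c a) (c a) = ∑ i, ∑ j, P a i * P a j * A (b i) (b j) := by
    intro a
    change hA.toLinearMap (c a) (c a) = ∑ i, ∑ j, P a i * P a j * hA.toLinearMap (b i) (b j)
    rw [hPe a]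
    simp only [map_sum, map_smul, LinearMap.sum_apply, LinearMap.smul_apply, smul_eq_mul,
      Finset.mul_sum]
    rw [Finset.sum_comm]
    exact Finset.sum_congr rfl fun i _ => Finset.sum_congr rfl fun j _ => by ring
  simp_rw [hsum, Matrix.mul_apply, Matrix.transpose_apply, Finset.sum_mul]
  rw [Finset.sum_comm]
  refine Finset.sum_congr rfl fun i _ => ?_
  rw [Finset.sum_comm]

end Frames

section Trace

variable {n : ℕ} {E : Type*} [NormedAddCommGroup E] [NormedSpace ℝ E]

theorem hasFDerivAt_ringInverse_of_eq_one {R : Type*} [NormedRing R] [NormedAlgebra ℝ R]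
    [CompleteSpace R] {X : E → R} {X' : E →L[ℝ] R} {p : E} (hX : HasFDerivAt X X' p)
    (hp : X p = 1) : HasFDerivAt (fun z => Ring.inverse (X z)) (-X') p := by
  have hinv := hasFDerivAt_ringInverse (𝕜 := ℝ) (1 : Rˣ)
  rw [Units.val_one, ← hp] at hinv
  refine (hinv.comp p hX).congr_fderiv (ContinuousLinearMap.ext fun v => ?_)
  change -(ContinuousLinearMap.mulLeftRight ℝ R _ _ (X' v)) = -X' v
  rw [ContinuousLinearMap.mulLeftRight_apply, inv_one, Units.val_one, one_mul, mul_one]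

/-- The case `X p = 1` suffices: the Gram matrix of a basis that is orthonormal at `p` is the
identity there, and the differential of the inverse is then `-dX`. -/
theorem hasFDerivAt_matrix_inv {m : Type*} [Fintype m] [DecidableEq m] {X : E → Matrix m m ℝ}
    {X' : m → m → E →L[ℝ] ℝ} {p : E}
    (hX : ∀ i j, HasFDerivAt (fun z => X z i j) (X' i j) p) (hp : X p = 1) (i j : m) :
    HasFDerivAt (fun z => (X z)⁻¹ i j) (-X' i j) p := by
  -- The norm on matrices is auxiliary; the conclusion concerns single entries.
  let _ := Matrix.linftyOpNormedRing (n := m) (α := ℝ)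
  let _ := Matrix.linftyOpNormedAlgebra (n := m) (R := ℝ) (α := ℝ)
  have : CompleteSpace (Matrix m m ℝ) := FiniteDimensional.complete ℝ _
  have hX1 : HasFDerivAt X (∑ i, ∑ j, (X' i j).smulRight (Matrix.single i j (1 : ℝ))) p := by
    have : X = fun z => ∑ i, ∑ j, X z i j • Matrix.single i j (1 : ℝ) := by
      funext z
      conv_lhs => rw [Matrix.matrix_eq_sum_single (X z)]
      simp
    rw [this]
    exact HasFDerivAt.fun_sum fun i _ => HasFDerivAt.fun_sum fun j _ =>
      (hX i j).smul_const _
  let ent : Matrix m m ℝ →L[ℝ] ℝ := LinearMap.toContinuousLinearMap (Matrix.entryLinearMap ℝ ℝ i j)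
  have h3 := ent.hasFDerivAt.comp p (hasFDerivAt_ringInverse_of_eq_one hX1 hp)
  have e1 : (fun z => (X z)⁻¹ i j) = ent ∘ fun z => Ring.inverse (X z) := by
    funext z
    simp [ent, Matrix.nonsing_inv_eq_ringInverse]
  rw [e1]
  refine h3.congr_fderiv ?_
  ext v
  change -((∑ i, ∑ j, (X' i j).smulRight (Matrix.single i j (1 : ℝ))) v) i j = _
  simp [Matrix.sum_apply, Matrix.single_apply, ite_and]

/-- The covariant derivative of a field of bilinear forms on a vector space, for the connection with
Christoffel symbols `S` at `p`. -/
noncomputable def chartCov₂ (S : E →L[ℝ] E →L[ℝ] E) (A : E → E → E → ℝ) (p w u v : E) : ℝ :=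
  fderiv ℝ (fun z => A z u v) p w - A p (S w u) v - A p u (S w v)

variable [FiniteDimensional ℝ E]

/-- In the fixed basis `b = c p` the trace is a combination of the `A z (b i) (b j)` with the
inverse Gram matrix as coefficients, an expression free of the irregular `c z`. At `p` the inverse
Gram matrix has differential `-dg`, and metric compatibility turns this into exactly the two
Christoffel terms of the covariant derivative of `A`. -/
theorem trace_differentiable {p : E} {g : E → E →L[ℝ] E →L[ℝ] ℝ}
    {S : E →L[ℝ] E →L[ℝ] E} {c : E → Fin n → E} {A : E → E → E → ℝ}
    (hn : Module.finrank ℝ E = n) (hg : DifferentiableAt ℝ g p)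
    (hmetric : ∀ w u v, fderiv ℝ g p w u v = g p (S w u) v + g p u (S w v))
    (hsymm : ∀ u v, g p u v = g p v u)
    (hc : ∀ᶠ z in nhds p, IsOrthonormalFor (g z) (c z))
    (hA : ∀ᶠ z in nhds p, IsBilinearMap ℝ (A z))
    (hA' : ∀ u v, DifferentiableAt ℝ (fun z => A z u v) p) :
    DifferentiableAt ℝ (fun z => ∑ a, A z (c z a) (c z a)) p ∧
      ∀ w, fderiv ℝ (fun z => ∑ a, A z (c z a) (c z a)) p w =
        ∑ a, chartCov₂ S A p w (c p a) (c p a) := by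
  have hcp := hc.self_of_nhds
  have hAp := hA.self_of_nhds
  set b := c p with hb
  have heq : (fun z => ∑ a, A z (c z a) (c z a)) =ᶠ[nhds p] fun z => ∑ i, ∑ j,
      (Matrix.of fun i j => g z (b i) (b j))⁻¹ i j * A z (b i) (b j) := by
    filter_upwards [hc, hA] with z hcz hAz
    exact hcp.sum_eq_inv hcz hn hAz
  have hG : ∀ i j, HasFDerivAt (fun z => (Matrix.of fun i j => g z (b i) (b j)) i j)
      (((fderiv ℝ g p).flip (b i)).flip (b j)) p := by
    intro i j
    simp only [Matrix.of_apply]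
    have := (hg.hasFDerivAt.clm_apply (hasFDerivAt_const (b i) p)).clm_apply
      (hasFDerivAt_const (b j) p)
    refine this.congr_fderiv ?_
    ext v; simp
  have hI := hasFDerivAt_matrix_inv (X := fun z => Matrix.of fun i j => g z (b i) (b j)) hG
    (by ext i j; simp [Matrix.one_apply, hcp i j])
  have hmain : HasFDerivAt (fun z => ∑ i, ∑ j,
      (Matrix.of fun i j => g z (b i) (b j))⁻¹ i j * A z (b i) (b j)) _ p :=
    HasFDerivAt.fun_sum fun i _ => HasFDerivAt.fun_sum fun j _ =>
      (hI i j).mul (hA' (b i) (b j)).hasFDerivAt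
  have hone : (Matrix.of fun i j => g p (b i) (b j))⁻¹ = (1 : Matrix (Fin n) (Fin n) ℝ) := by
    have : (Matrix.of fun i j => g p (b i) (b j)) = (1 : Matrix (Fin n) (Fin n) ℝ) := by
      ext i j; simp [Matrix.one_apply, hcp i j]
    rw [this, inv_one]
  have hmain' := hmain.congr_of_eventuallyEq heq
  refine ⟨hmain'.differentiableAt, fun w => ?_⟩
  rw [hmain'.fderiv]
  have key : ∀ i, A p (S w (b i)) (b i) = ∑ j, g p (S w (b i)) (b j) * A p (b j) (b i) := by
    intro i
    conv_lhs => rw [hcp.expand hn (S w (b i))]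
    change hAp.toLinearMap _ _ = ∑ j, _ * hAp.toLinearMap _ _
    simp
  have key' : ∀ i, A p (b i) (S w (b i)) = ∑ j, g p (S w (b i)) (b j) * A p (b i) (b j) := by
    intro i
    conv_lhs => rw [hcp.expand hn (S w (b i))]
    change hAp.toLinearMap _ _ = ∑ j, _ * hAp.toLinearMap _ _
    simp
  simp only [chartCov₂, key, key', hone]
  simp only [sum_apply, add_apply, smul_apply, neg_apply, ContinuousLinearMap.flip_apply,
    hmetric, smul_eq_mul, Matrix.one_apply, ite_mul, one_mul, zero_mul,
    Finset.sum_add_distrib, Finset.sum_ite_eq, Finset.mem_univ, if_true, Finset.sum_sub_distrib]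
  have e2 : ∑ i, ∑ j, g p (S w (b i)) (b j) * A p (b j) (b i) =
      ∑ i, ∑ j, g p (S w (b j)) (b i) * A p (b i) (b j) := Finset.sum_comm
  rw [e2, sub_sub]
  simp only [← Finset.sum_add_distrib, ← Finset.sum_sub_distrib]
  refine Finset.sum_congr rfl fun i _ => ?_
  rw [sub_eq_add_neg, ← Finset.sum_neg_distrib]
  congr 1
  refine Finset.sum_congr rfl fun j _ => ?_
  rw [hsymm (b i)]
  ring

end Trace

/-! ### Derivatives of evaluated families of multilinear maps -/

section Calculus

variable {E A B C D : Type*} [NormedAddCommGroup E] [NormedSpace ℝ E] [NormedAddCommGroup A]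
  [NormedSpace ℝ A] [NormedAddCommGroup B] [NormedSpace ℝ B] [NormedAddCommGroup C]
  [NormedSpace ℝ C] [NormedAddCommGroup D] [NormedSpace ℝ D] {p : E}

theorem differentiableAt_clm_apply₂ {S : E → A →L[ℝ] B →L[ℝ] C} {a : E → A} {b : E → B}
    (hS : DifferentiableAt ℝ S p) (ha : DifferentiableAt ℝ a p) (hb : DifferentiableAt ℝ b p) :
    DifferentiableAt ℝ (fun z => S z (a z) (b z)) p :=
  (hS.clm_apply ha).clm_apply hb

theorem fderiv_clm_apply₂ {S : E → A →L[ℝ] B →L[ℝ] C} {a : E → A} {b : E → B}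
    (hS : DifferentiableAt ℝ S p) (ha : DifferentiableAt ℝ a p) (hb : DifferentiableAt ℝ b p)
    (q : E) : fderiv ℝ (fun z => S z (a z) (b z)) p q = fderiv ℝ S p q (a p) (b p)
      + S p (fderiv ℝ a p q) (b p) + S p (a p) (fderiv ℝ b p q) := by
  rw [((hS.hasFDerivAt.clm_apply ha.hasFDerivAt).clm_apply hb.hasFDerivAt).fderiv]
  simp only [add_apply, ContinuousLinearMap.comp_apply, ContinuousLinearMap.flip_apply]
  abel

theorem fderiv_clm_apply_const₂ {S : E → A →L[ℝ] B →L[ℝ] C} (hS : DifferentiableAt ℝ S p)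
    (a : A) (b : B) (q : E) : fderiv ℝ (fun z => S z a b) p q = fderiv ℝ S p q a b := by
  rw [fderiv_clm_apply₂ hS (differentiableAt_const a) (differentiableAt_const b)]
  simp

theorem differentiableAt_clm_apply_const₃ {S : E → A →L[ℝ] B →L[ℝ] C →L[ℝ] D}
    (hS : DifferentiableAt ℝ S p) (a : A) (b : B) (c : C) :
    DifferentiableAt ℝ (fun z => S z a b c) p :=
  (differentiableAt_clm_apply₂ hS (differentiableAt_const a) (differentiableAt_const b)).clm_apply
    (differentiableAt_const c)

theorem fderiv_clm_apply_const₃ {S : E → A →L[ℝ] B →L[ℝ] C →L[ℝ] D}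
    (hS : DifferentiableAt ℝ S p) (a : A) (b : B) (c : C) (q : E) :
    fderiv ℝ (fun z => S z a b c) p q = fderiv ℝ S p q a b c := by
  have h := differentiableAt_clm_apply₂ hS (differentiableAt_const a) (differentiableAt_const b)
  rw [(h.hasFDerivAt.clm_apply (hasFDerivAt_const c p)).fderiv]
  simp only [add_apply, ContinuousLinearMap.comp_apply, ContinuousLinearMap.flip_apply,
    zero_apply, map_zero, zero_add]
  rw [fderiv_clm_apply_const₂ hS]

theorem fderiv_add_const_smul {S τ : E → A} (hS : DifferentiableAt ℝ S p)
    (hτ : DifferentiableAt ℝ τ p) (r : ℝ) :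
    fderiv ℝ (fun z => S z + r • τ z) p = fderiv ℝ S p + r • fderiv ℝ τ p :=
  (hS.hasFDerivAt.add (hτ.hasFDerivAt.const_smul r)).fderiv

theorem ContDiffAt.differentiableAt_fderiv {S : E → A} (hS : ContDiffAt ℝ 2 S p) :
    DifferentiableAt ℝ (fderiv ℝ S) p :=
  (hS.fderiv_right (m := 1) (by norm_num)).differentiableAt (by norm_num)

end Calculus

/-! ### Curvature from Christoffel symbols and its symmetries -/

section ChartCurvature

variable {n : ℕ} {E : Type*} [NormedAddCommGroup E] [NormedSpace ℝ E]

/-- The curvature of the connection with Christoffel symbols `Γ`. -/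
noncomputable def chartRm (Γ : E → E →L[ℝ] E →L[ℝ] E) (z u v w : E) : E :=
  fderiv ℝ Γ z u v w - fderiv ℝ Γ z v u w + Γ z u (Γ z v w) - Γ z v (Γ z u w)

/-- The covariant derivative of the curvature. -/
noncomputable def chartCovRm (S : E → E →L[ℝ] E →L[ℝ] E) (p w q u v : E) : E :=
  fderiv ℝ (fun z => chartRm S z q u v) p w + S p w (chartRm S p q u v)
    - chartRm S p (S p w q) u v - chartRm S p q (S p w u) v - chartRm S p q u (S p w v)

/-- The covariant derivative of a field `τ` of vector-valued bilinear maps. -/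
noncomputable def chartCovBilin (S τ : E → E →L[ℝ] E →L[ℝ] E) (p w u v : E) : E :=
  fderiv ℝ τ p w u v + S p w (τ p u v) - τ p (S p w u) v - τ p u (S p w v)

/-- The covariant derivative of a field of trilinear forms. -/
noncomputable def chartCov₃ (S : E →L[ℝ] E →L[ℝ] E) (A : E → E → E → E → ℝ) (p w u v t : E) : ℝ :=
  fderiv ℝ (fun z => A z u v t) p w - A p (S w u) v t - A p u (S w v) t - A p u v (S w t)

theorem chartRm_swap (Γ : E → E →L[ℝ] E →L[ℝ] E) (z u v w : E) :
    chartRm Γ z u v w = -chartRm Γ z v u w := by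
  simp only [chartRm]; abel

theorem chartRm_add_right (Γ : E → E →L[ℝ] E →L[ℝ] E) (z u v w w' : E) :
    chartRm Γ z u v (w + w') = chartRm Γ z u v w + chartRm Γ z u v w' := by
  simp only [chartRm, map_add]; abel

theorem chartRm_smul_right (Γ : E → E →L[ℝ] E →L[ℝ] E) (z u v w : E) (r : ℝ) :
    chartRm Γ z u v (r • w) = r • chartRm Γ z u v w := by
  simp only [chartRm, map_smul]; module

theorem chartRm_add_left (Γ : E → E →L[ℝ] E →L[ℝ] E) (z u u' v w : E) :
    chartRm Γ z (u + u') v w = chartRm Γ z u v w + chartRm Γ z u' v w := by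
  simp only [chartRm, map_add, add_apply]; abel

theorem chartRm_smul_left (Γ : E → E →L[ℝ] E →L[ℝ] E) (z u v w : E) (r : ℝ) :
    chartRm Γ z (r • u) v w = r • chartRm Γ z u v w := by
  simp only [chartRm, map_smul, smul_apply]; module

theorem chartRm_add_mid (Γ : E → E →L[ℝ] E →L[ℝ] E) (z u v v' w : E) :
    chartRm Γ z u (v + v') w = chartRm Γ z u v w + chartRm Γ z u v' w := by
  simp only [chartRm, map_add, add_apply]; abel

theorem chartRm_smul_mid (Γ : E → E →L[ℝ] E →L[ℝ] E) (z u v w : E) (r : ℝ) :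
    chartRm Γ z u (r • v) w = r • chartRm Γ z u v w := by
  simp only [chartRm, map_smul, smul_apply]; module

/-- The terms `τ (S u v) w` and `τ (S v u) w` of the two covariant derivatives cancel because `S` is
symmetric. The coefficient `1/4` is the square of the `1/2` in front of `τ`. -/
theorem chartRm_add_half {S τ : E → E →L[ℝ] E →L[ℝ] E} {p : E}
    (hS : DifferentiableAt ℝ S p) (hτ : DifferentiableAt ℝ τ p)
    (hsymm : ∀ u v, S p u v = S p v u) (u v w : E) :
    chartRm (fun z => S z + (1 / 2 : ℝ) • τ z) p u v w =
      chartRm S p u v w + (1 / 2 : ℝ) • chartCovBilin S τ p u v w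
        - (1 / 2 : ℝ) • chartCovBilin S τ p v u w
        + (1 / 4 : ℝ) • (τ p u (τ p v w) - τ p v (τ p u w)) := by
  have hd : fderiv ℝ (fun z => S z + (1 / 2 : ℝ) • τ z) p
      = fderiv ℝ S p + (1 / 2 : ℝ) • fderiv ℝ τ p :=
    fderiv_add_const_smul (A := E →L[ℝ] E →L[ℝ] E) hS hτ _
  simp only [chartRm, chartCovBilin, hd, add_apply, smul_apply, map_add, map_smul, hsymm v u]
  module

theorem differentiableAt_chartRm {S : E → E →L[ℝ] E →L[ℝ] E} {p : E} (hS : ContDiffAt ℝ 2 S p)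
    (u v w : E) : DifferentiableAt ℝ (fun z => chartRm S z u v w) p ∧
      ∀ q, fderiv ℝ (fun z => chartRm S z u v w) p q =
        fderiv ℝ (fderiv ℝ S) p q u v w - fderiv ℝ (fderiv ℝ S) p q v u w
          + fderiv ℝ S p q u (S p v w) + S p u (fderiv ℝ S p q v w)
          - fderiv ℝ S p q v (S p u w) - S p v (fderiv ℝ S p q u w) := by
  have h1 : DifferentiableAt ℝ S p := hS.differentiableAt (by norm_num)
  have h2 : DifferentiableAt ℝ (fderiv ℝ S) p := ContDiffAt.differentiableAt_fderiv hS
  have c : ∀ x : E, DifferentiableAt ℝ (fun _ : E => x) p := fun x => differentiableAt_const x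
  have a1 := fun u v w => differentiableAt_clm_apply_const₃ h2 u v w
  have b1 := fun u v w => fderiv_clm_apply_const₃ h2 u v w
  have a0 := fun v w => differentiableAt_clm_apply₂ h1 (c v) (c w)
  have b0 := fun v w => fderiv_clm_apply_const₂ h1 v w
  have a2 := fun u v w => differentiableAt_clm_apply₂ h1 (c u) (a0 v w)
  have b2 := fun u v w => fderiv_clm_apply₂ h1 (c u) (a0 v w)
  have h := (((a1 u v w).hasFDerivAt.fun_sub (a1 v u w).hasFDerivAt).fun_add
    (a2 u v w).hasFDerivAt).fun_sub (a2 v u w).hasFDerivAt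
  refine ⟨h.differentiableAt, fun q => ?_⟩
  change fderiv ℝ (fun z => fderiv ℝ S z u v w - fderiv ℝ S z v u w + S z u (S z v w)
    - S z v (S z u w)) p q = _
  rw [h.fderiv]
  simp only [add_apply, sub_apply, b1, b2, b0, fderiv_const_apply, zero_apply, map_zero, add_zero]
  abel

/-- The second Bianchi identity. The second derivatives of `S` cancel by their symmetry, everything
else by the symmetry of `S`. -/
theorem chartCovRm_cyclic {S : E → E →L[ℝ] E →L[ℝ] E} {p : E} (hS : ContDiffAt ℝ 2 S p)
    (hsymm : ∀ᶠ z in nhds p, ∀ u v, S z u v = S z v u) (w q u v : E) :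
    chartCovRm S p w q u v + chartCovRm S p q u w v + chartCovRm S p u w q v = 0 := by
  have hs := hsymm.self_of_nhds
  have hsnd := hS.isSymmSndFDerivAt (by simp)
  have hsd : ∀ a b c d, fderiv ℝ (fderiv ℝ S) p a b c d = fderiv ℝ (fderiv ℝ S) p b a c d :=
    fun a b c d => by rw [hsnd.eq a b]
  have hD := fun u v w q => (differentiableAt_chartRm hS u v w).2 q
  simp only [chartCovRm, hD]
  simp only [chartRm, map_add, map_sub]
  rw [hsd q w, hsd u w, hsd u q, hs q w, hs u w, hs u q]
  abel

/-- The first Bianchi identity. Symmetry of `S` is needed near `p`, since it also has to be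
differentiated. -/
theorem chartRm_cyclic {S : E → E →L[ℝ] E →L[ℝ] E} {p : E} (hS : DifferentiableAt ℝ S p)
    (hsymm : ∀ᶠ z in nhds p, ∀ u v, S z u v = S z v u) (u v w : E) :
    chartRm S p u v w + chartRm S p v w u + chartRm S p w u v = 0 := by
  have hs := hsymm.self_of_nhds
  have hd : ∀ q a b, fderiv ℝ S p q a b = fderiv ℝ S p q b a := by
    intro q a b
    have e : (fun z => S z a b) =ᶠ[nhds p] fun z => S z b a := by
      filter_upwards [hsymm] with z hz using hz a b
    have h : ∀ a b : E, fderiv ℝ (fun z => S z a b) p q = fderiv ℝ S p q a b := by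
      intro a b
      exact fderiv_clm_apply_const₂ hS a b q
    rw [← h, ← h, e.fderiv_eq]
  simp only [chartRm]
  rw [hd v w u, hd u w v, hd w v u, hs w u, hs v u, hs w v]
  abel

/-- Differentiate the compatibility of `S` with `g` once more and antisymmetrise in the two
directions: the second derivatives of `g` cancel and curvature is left. -/
theorem chartRm_metric_skew {S : E → E →L[ℝ] E →L[ℝ] E} {g : E → E →L[ℝ] E →L[ℝ] ℝ} {p : E}
    (hS : DifferentiableAt ℝ S p) (hg : ContDiffAt ℝ 2 g p)
    (hmetric : ∀ᶠ z in nhds p, ∀ w u v, fderiv ℝ g z w u v = g z (S z w u) v + g z u (S z w v))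
    (u v w t : E) : g p (chartRm S p u v w) t = -g p w (chartRm S p u v t) := by
  have hm := hmetric.self_of_nhds
  have h1 : DifferentiableAt ℝ g p := hg.differentiableAt (by norm_num)
  have h2 : DifferentiableAt ℝ (fderiv ℝ g) p := ContDiffAt.differentiableAt_fderiv hg
  have hsnd := hg.isSymmSndFDerivAt (by simp)
  have c : ∀ x : E, DifferentiableAt ℝ (fun _ : E => x) p := fun x => differentiableAt_const x
  have key : ∀ u v, fderiv ℝ (fderiv ℝ g) p u v w t =
      fderiv ℝ g p u (S p v w) t + g p (fderiv ℝ S p u v w) t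
        + (fderiv ℝ g p u w (S p v t) + g p w (fderiv ℝ S p u v t)) := by
    intro u v
    have e : (fun z => fderiv ℝ g z v w t) =ᶠ[nhds p]
        fun z => g z (S z v w) t + g z w (S z v t) := by
      filter_upwards [hmetric] with z hz using hz v w t
    have s1 := fun a b => differentiableAt_clm_apply₂ hS (c a) (c b)
    rw [← fderiv_clm_apply_const₃ h2, e.fderiv_eq,
      fderiv_fun_add (differentiableAt_clm_apply₂ h1 (s1 v w) (c t))
        (differentiableAt_clm_apply₂ h1 (c w) (s1 v t)), add_apply,
      fderiv_clm_apply₂ h1 (s1 v w) (c t), fderiv_clm_apply₂ h1 (c w) (s1 v t),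
      fderiv_clm_apply_const₂ hS, fderiv_clm_apply_const₂ hS]
    simp only [fderiv_const_apply, zero_apply, map_zero, add_zero]
  have k1 := key u v
  have k2 := key v u
  rw [hsnd.eq u v, k2] at k1
  simp only [hm] at k1
  simp only [chartRm, map_add, map_sub, add_apply, sub_apply]
  linear_combination -k1

variable {S τ : E → E →L[ℝ] E →L[ℝ] E} {g : E → E →L[ℝ] E →L[ℝ] ℝ} {p : E}

/-- Since `g` is parallel, it passes through the covariant derivative; `inner_chartCovRm` is the
same fact for the curvature. -/
theorem inner_chartCovBilin (hg : DifferentiableAt ℝ g p) (hτ : DifferentiableAt ℝ τ p)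
    (hm : ∀ w u v, fderiv ℝ g p w u v = g p (S p w u) v + g p u (S p w v)) (w u v t : E) :
    g p (chartCovBilin S τ p w u v) t =
      chartCov₃ (S p) (fun z u v t => g z (τ z u v) t) p w u v t := by
  have c : ∀ x : E, DifferentiableAt ℝ (fun _ : E => x) p := fun x => differentiableAt_const x
  rw [chartCov₃, fderiv_clm_apply₂ hg (differentiableAt_clm_apply₂ hτ (c u) (c v)) (c t),
    fderiv_clm_apply_const₂ hτ]
  simp only [chartCovBilin, hm, fderiv_const_apply, zero_apply, map_zero, map_add, map_sub,
    add_apply, sub_apply]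
  ring

theorem inner_chartCovRm (hg : DifferentiableAt ℝ g p) (hS : ContDiffAt ℝ 2 S p)
    (hm : ∀ w u v, fderiv ℝ g p w u v = g p (S p w u) v + g p u (S p w v)) (w q u v t : E) :
    fderiv ℝ (fun z => g z (chartRm S z q u v) t) p w - g p (chartRm S p (S p w q) u v) t
      - g p (chartRm S p q (S p w u) v) t - g p (chartRm S p q u (S p w v)) t
      - g p (chartRm S p q u v) (S p w t) = g p (chartCovRm S p w q u v) t := by
  rw [fderiv_clm_apply₂ hg (differentiableAt_chartRm hS q u v).1 (differentiableAt_const t)]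
  simp only [chartCovRm, hm, fderiv_const_apply, zero_apply, map_zero, map_add, map_sub,
    add_apply, sub_apply]
  ring

end ChartCurvature

/-! ### The local model: pointwise symmetries of torsion and curvature -/

section ChartModel

variable {n : ℕ} {E : Type*} [NormedAddCommGroup E] [NormedSpace ℝ E]

/-- The Ricci tensor of the connection with Christoffel symbols `Γ`, in the frame `c`. -/
noncomputable def chartRic (g : E → E →L[ℝ] E →L[ℝ] ℝ) (Γ : E → E →L[ℝ] E →L[ℝ] E)
    (c : E → Fin n → E) (z u v : E) : ℝ :=
  ∑ a, g z (chartRm Γ z (c z a) u v) (c z a)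

/-- The scalar curvature of the connection with Christoffel symbols `Γ`, in the frame `c`. -/
noncomputable def chartScal (g : E → E →L[ℝ] E →L[ℝ] ℝ) (Γ : E → E →L[ℝ] E →L[ℝ] E)
    (c : E → Fin n → E) (z : E) : ℝ :=
  ∑ i, chartRic g Γ c z (c z i) (c z i)

/-- The covariant torsion tensor. -/
noncomputable def chartT (g : E → E →L[ℝ] E →L[ℝ] ℝ) (τ : E → E →L[ℝ] E →L[ℝ] E)
    (z u v w : E) : ℝ :=
  g z (τ z u v) w

/-- The contraction of a trilinear form with itself in two arguments. -/
noncomputable def chartSq (T : E → E → E → E → ℝ) (c : E → Fin n → E) (z u v : E) : ℝ :=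
  ∑ a, ∑ b, T z u (c z a) (c z b) * T z v (c z a) (c z b)

/-- The square norm of a trilinear form. -/
noncomputable def chartNorm (T : E → E → E → E → ℝ) (c : E → Fin n → E) (z : E) : ℝ :=
  ∑ a, chartSq T c z (c z a) (c z a)

/-- Local data near `p`: a metric `g`, its Levi-Civita connection with Christoffel symbols `S`, a
totally skew torsion `τ`, and an orthonormal frame `c` without any regularity. -/
structure ChartModel (g : E → E →L[ℝ] E →L[ℝ] ℝ) (S τ : E → E →L[ℝ] E →L[ℝ] E)
    (c : E → Fin n → E) (p : E) : Prop where
  finrank_eq : Module.finrank ℝ E = n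
  contDiff_g : ContDiffAt ℝ 2 g p
  contDiff_S : ContDiffAt ℝ 2 S p
  contDiff_τ : ContDiffAt ℝ 2 τ p
  symm_g : ∀ᶠ z in nhds p, ∀ u v, g z u v = g z v u
  symm_S : ∀ᶠ z in nhds p, ∀ u v, S z u v = S z v u
  metric : ∀ᶠ z in nhds p, ∀ w u v, fderiv ℝ g z w u v = g z (S z w u) v + g z u (S z w v)
  skew₁₂ : ∀ᶠ z in nhds p, ∀ u v, τ z u v = -τ z v u
  skew₂₃ : ∀ᶠ z in nhds p, ∀ u v w, g z (τ z u v) w = -g z (τ z u w) v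
  frame : ∀ᶠ z in nhds p, IsOrthonormalFor (g z) (c z)

namespace ChartModel

variable {g : E → E →L[ℝ] E →L[ℝ] ℝ} {S τ : E → E →L[ℝ] E →L[ℝ] E} {c : E → Fin n → E} {p : E}

/-- An identity derived at `p` from the model thus holds at all nearby points and may be
differentiated. The finite order `C²` makes the regularity assumptions open conditions. -/
theorem eventually (h : ChartModel g S τ c p) : ∀ᶠ z in nhds p, ChartModel g S τ c z := by
  have e := fun {F : Type _} [NormedAddCommGroup F] [NormedSpace ℝ F] {f : E → F}
    (hf : ContDiffAt ℝ 2 f p) => hf.eventually (by norm_num)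
  filter_upwards [e h.contDiff_g, e h.contDiff_S, e h.contDiff_τ, h.symm_g.eventually_nhds,
    h.symm_S.eventually_nhds, h.metric.eventually_nhds, h.skew₁₂.eventually_nhds,
    h.skew₂₃.eventually_nhds, h.frame.eventually_nhds] with z h1 h2 h3 h4 h5 h6 h7 h8 h9
  exact ⟨h.finrank_eq, h1, h2, h3, h4, h5, h6, h7, h8, h9⟩

theorem differentiable_g (h : ChartModel g S τ c p) : DifferentiableAt ℝ g p :=
  h.contDiff_g.differentiableAt (by norm_num)
theorem differentiable_S (h : ChartModel g S τ c p) : DifferentiableAt ℝ S p :=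
  h.contDiff_S.differentiableAt (by norm_num)
theorem differentiable_τ (h : ChartModel g S τ c p) : DifferentiableAt ℝ τ p :=
  h.contDiff_τ.differentiableAt (by norm_num)

theorem T_swap₁₂ (h : ChartModel g S τ c p)
    (u v w : E) : chartT g τ p u v w = -chartT g τ p v u w := by
  simp only [chartT, h.skew₁₂.self_of_nhds u v, map_neg, neg_apply]

theorem T_swap₂₃ (h : ChartModel g S τ c p)
    (u v w : E) : chartT g τ p u v w = -chartT g τ p u w v :=
  h.skew₂₃.self_of_nhds u v w

theorem differentiable_T (h : ChartModel g S τ c p)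
    (u v w : E) : DifferentiableAt ℝ (fun z => chartT g τ z u v w) p :=
  differentiableAt_clm_apply₂ h.differentiable_g
    (differentiableAt_clm_apply₂ h.differentiable_τ (differentiableAt_const u)
      (differentiableAt_const v)) (differentiableAt_const w)

theorem cov_swap₁₂ (h : ChartModel g S τ c p)
    (w u v t : E) : chartCov₃ (S p) (chartT g τ) p w u v t =
    -chartCov₃ (S p) (chartT g τ) p w v u t := by
  have e : (fun z => chartT g τ z u v t) =ᶠ[nhds p] fun z => -chartT g τ z v u t := by
    filter_upwards [h.eventually] with z hz using hz.T_swap₁₂ u v t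
  simp only [chartCov₃, e.fderiv_eq, fderiv_fun_neg, neg_apply]
  linarith [h.T_swap₁₂ (S p w u) v t, h.T_swap₁₂ u (S p w v) t, h.T_swap₁₂ u v (S p w t)]

theorem cov_swap₂₃ (h : ChartModel g S τ c p)
    (w u v t : E) : chartCov₃ (S p) (chartT g τ) p w u v t =
    -chartCov₃ (S p) (chartT g τ) p w u t v := by
  have e : (fun z => chartT g τ z u v t) =ᶠ[nhds p] fun z => -chartT g τ z u t v := by
    filter_upwards [h.eventually] with z hz using hz.T_swap₂₃ u v t
  simp only [chartCov₃, e.fderiv_eq, fderiv_fun_neg, neg_apply]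
  linarith [h.T_swap₂₃ (S p w u) v t, h.T_swap₂₃ u (S p w v) t, h.T_swap₂₃ u v (S p w t)]

/-- The curvature of the connection with torsion in terms of the Riemannian one. -/
theorem rm_eq (h : ChartModel g S τ c p)
    (u v w t : E) :
    g p (chartRm (fun z => S z + (1 / 2 : ℝ) • τ z) p u v w) t =
      g p (chartRm S p u v w) t + 1 / 2 * chartCov₃ (S p) (chartT g τ) p u v w t
        - 1 / 2 * chartCov₃ (S p) (chartT g τ) p v u w t
        + 1 / 4 * (g p (τ p v t) (τ p u w) - g p (τ p u t) (τ p v w)) := by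
  rw [chartRm_add_half h.differentiable_S h.differentiable_τ h.symm_S.self_of_nhds]
  have hm := h.metric.self_of_nhds
  have e : ∀ u v w t, g p (chartCovBilin S τ p u v w) t =
      chartCov₃ (S p) (chartT g τ) p u v w t := fun u v w t =>
    inner_chartCovBilin h.differentiable_g h.differentiable_τ hm u v w t
  -- Skewness moves the outer torsion onto `t`, so that the quadratic terms become inner products of
  -- two torsions.
  have s := h.skew₂₃.self_of_nhds
  simp only [map_add, map_sub, map_smul, add_apply, sub_apply, smul_apply, smul_eq_mul, e,
    s u (τ p v w) t, s v (τ p u w) t]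
  ring

theorem inner_expand [FiniteDimensional ℝ E] (h : ChartModel g S τ c p)
    (u v : E) : g p u v = ∑ a, g p u (c p a) * g p v (c p a) := by
  conv_lhs => rw [h.frame.self_of_nhds.expand h.finrank_eq v]
  simp [mul_comm]

theorem inner_τ [FiniteDimensional ℝ E] (h : ChartModel g S τ c p)
    (u v w t : E) : g p (τ p u v) (τ p w t) =
    ∑ a, chartT g τ p u v (c p a) * chartT g τ p w t (c p a) :=
  h.inner_expand _ _

/-- After contraction, a term in `∇ᵍT` either repeats the frame vector among the arguments of `T`
and vanishes, or is skew in `u, v` and cancels in the symmetrisation. The quadratic terms contribute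
`-T²/4` for each order of `u, v`. -/
theorem ric_symm_part [FiniteDimensional ℝ E] (h : ChartModel g S τ c p)
    (u v : E) :
    chartRic g (fun z => S z + (1 / 2 : ℝ) • τ z) c p u v
      + chartRic g (fun z => S z + (1 / 2 : ℝ) • τ z) c p v u =
    chartRic g S c p u v + chartRic g S c p v u - 1 / 2 * chartSq (chartT g τ) c p u v := by
  simp only [chartRic, chartSq, h.rm_eq, h.inner_τ]
  rw [Finset.mul_sum, ← Finset.sum_add_distrib, ← Finset.sum_add_distrib,
    ← Finset.sum_sub_distrib]
  refine Finset.sum_congr rfl fun a _ => ?_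
  have z0 : ∀ w, chartT g τ p (c p a) (c p a) w = 0 := fun w => by
    linarith [h.T_swap₁₂ (c p a) (c p a) w]
  have z1 : ∀ w u, chartCov₃ (S p) (chartT g τ) p w (c p a) u (c p a) = 0 := fun w u => by
    linarith [h.cov_swap₁₂ w (c p a) u (c p a), h.cov_swap₂₃ w u (c p a) (c p a)]
  have z2 : chartCov₃ (S p) (chartT g τ) p (c p a) u v (c p a)
      = - chartCov₃ (S p) (chartT g τ) p (c p a) v u (c p a) := h.cov_swap₁₂ _ _ _ _
  have z3 : ∑ i, chartT g τ p u (c p a) (c p i) * chartT g τ p (c p a) v (c p i)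
      = -∑ i, chartT g τ p u (c p a) (c p i) * chartT g τ p v (c p a) (c p i) := by
    rw [← Finset.sum_neg_distrib]
    exact Finset.sum_congr rfl fun i _ => by rw [h.T_swap₁₂ (c p a) v]; ring
  have z4 : ∑ i, chartT g τ p v (c p a) (c p i) * chartT g τ p (c p a) u (c p i)
      = -∑ i, chartT g τ p u (c p a) (c p i) * chartT g τ p v (c p a) (c p i) := by
    rw [← Finset.sum_neg_distrib]
    exact Finset.sum_congr rfl fun i _ => by rw [h.T_swap₁₂ (c p a) u]; ring
  simp only [z0, z1, z3, z4, zero_mul, Finset.sum_const_zero, z2]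
  ring

theorem rm_metric_skew (h : ChartModel g S τ c p)
    (u v w t : E) :
    g p (chartRm S p u v w) t = -g p (chartRm S p u v t) w := by
  rw [chartRm_metric_skew h.differentiable_S h.contDiff_g h.metric,
    h.symm_g.self_of_nhds w]

/-- The usual derivation: four instances of the first Bianchi identity combined with skewness in the
first and in the last pair. -/
theorem rm_pair_symm (h : ChartModel g S τ c p)
    (u v w t : E) :
    g p (chartRm S p u v w) t = g p (chartRm S p w t u) v := by
  have sk := fun u v w t => h.rm_metric_skew u v w t
  have sw : ∀ u v w t, g p (chartRm S p u v w) t = -g p (chartRm S p v u w) t := fun u v w t => by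
    rw [chartRm_swap, map_neg, neg_apply]
  have cy : ∀ u v w t, g p (chartRm S p u v w) t + g p (chartRm S p v w u) t
      + g p (chartRm S p w u v) t = 0 := fun u v w t => by
    rw [← add_apply, ← map_add, ← add_apply, ← map_add,
      chartRm_cyclic h.differentiable_S h.symm_S, map_zero, zero_apply]
  linarith [cy v w u t, cy w u t v, cy u t v w, cy t v w u, sk v w u t, sk w u v t, sk u t w v,
    sk t v w u, sk u v w t, sk w t u v, sw u v w t, sw u v t w, sw t w u v, sw u w t v,
    sw w t v u, sk u v t w, sw t v u w, sw v t u w, sk v t u w, sk w u t v, sk u t v w, sk t v u w,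
    sw w u v t, sw u t w v, sk w t v u, sw v w t u, sk v w t u, sw w t u v]

theorem ric_symm (h : ChartModel g S τ c p)
    (u v : E) : chartRic g S c p u v = chartRic g S c p v u := by
  refine Finset.sum_congr rfl fun a _ => ?_
  rw [h.rm_pair_symm, chartRm_swap, map_neg, neg_apply, h.rm_metric_skew, neg_neg]

theorem covRm_metric_skew (h : ChartModel g S τ c p)
    (w q u v t : E) :
    g p (chartCovRm S p w q u v) t = -g p (chartCovRm S p w q u t) v := by
  have hm := h.metric.self_of_nhds
  rw [← inner_chartCovRm h.differentiable_g h.contDiff_S hm,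
    ← inner_chartCovRm h.differentiable_g h.contDiff_S hm]
  have e : (fun z => g z (chartRm S z q u v) t) =ᶠ[nhds p] fun z => -g z (chartRm S z q u t) v := by
    filter_upwards [h.eventually] with z hz using hz.rm_metric_skew q u v t
  simp only [e.fderiv_eq, fderiv_fun_neg, neg_apply]
  linarith [h.rm_metric_skew (S p w q) u v t, h.rm_metric_skew q (S p w u) v t,
    h.rm_metric_skew q u (S p w v) t, h.rm_metric_skew q u v (S p w t)]

theorem covRm_swap (w q u v : E) : chartCovRm S p w q u v = -chartCovRm S p w u q v := by
  have e : (fun z => chartRm S z q u v) = fun z => -chartRm S z u q v := by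
    funext z; exact chartRm_swap S z q u v
  simp only [chartCovRm, e, fderiv_fun_neg, neg_apply, chartRm_swap S p q, map_neg,
    chartRm_swap S p (S p w q)]
  abel

end ChartModel

end ChartModel

/-! ### The local model: derivatives of traces, the Einstein identity, the divergence of `T²` -/

namespace ChartModel

variable {n : ℕ} {E : Type*} [NormedAddCommGroup E] [NormedSpace ℝ E]
  {g : E → E →L[ℝ] E →L[ℝ] ℝ} {S τ : E → E →L[ℝ] E →L[ℝ] E} {c : E → Fin n → E} {p : E}

theorem isBilinearMap_ric (z : E) : IsBilinearMap ℝ (chartRic g S c z) where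
  add_left u v w := by
    simp only [chartRic, chartRm_add_mid, map_add, add_apply, Finset.sum_add_distrib]
  smul_left r u v := by
    simp only [chartRic, chartRm_smul_mid, map_smul, smul_apply, smul_eq_mul, Finset.mul_sum]
  add_right u v w := by
    simp only [chartRic, chartRm_add_right, map_add, add_apply, Finset.sum_add_distrib]
  smul_right r u v := by
    simp only [chartRic, chartRm_smul_right, map_smul, smul_apply, smul_eq_mul, Finset.mul_sum]

theorem isBilinearMap_sq (z : E) : IsBilinearMap ℝ (chartSq (chartT g τ) c z) where
  add_left u v w := by
    simp only [chartSq, chartT, map_add, add_apply, add_mul, Finset.sum_add_distrib]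
  smul_left r u v := by
    simp only [chartSq, chartT, map_smul, smul_apply, smul_eq_mul, Finset.mul_sum, mul_assoc]
  add_right u v w := by
    simp only [chartSq, chartT, map_add, add_apply, mul_add, Finset.sum_add_distrib]
  smul_right r u v := by
    simp only [chartSq, chartT, map_smul, smul_apply, smul_eq_mul, Finset.mul_sum, mul_left_comm]

/-- If the curvature of the connection with torsion is pair symmetric, `∇T` is a 4-form. -/
theorem cov_T_swap_of_pair_symm (h : ChartModel g S τ c p)
    (hR : ∀ u v w t, g p (chartRm (fun z => S z + (1 / 2 : ℝ) • τ z) p u v w) t =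
      g p (chartRm (fun z => S z + (1 / 2 : ℝ) • τ z) p w t u) v) (u v w t : E) :
    chartCov₃ (S p) (chartT g τ) p u v w t = -chartCov₃ (S p) (chartT g τ) p v u w t := by
  set D := chartCov₃ (S p) (chartT g τ) p
  have t12 : ∀ x u v w, D x u v w = -D x v u w := h.cov_swap₁₂
  have t23 : ∀ x u v w, D x u v w = -D x u w v := h.cov_swap₂₃
  have gs := h.symm_g.self_of_nhds
  have hs := h.skew₁₂.self_of_nhds
  -- The Riemannian curvature and the quadratic torsion terms are pair symmetric by themselves, so
  -- the hypothesis is a linear condition on `∇ᵍT`.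
  have key : ∀ u v w t, D u v w t - D v u w t - D w t u v + D t w u v = 0 := by
    intro u v w t
    have h1 := hR u v w t
    rw [h.rm_eq, h.rm_eq, h.rm_pair_symm u v w t] at h1
    have q1 : g p (τ p t v) (τ p w u) = g p (τ p v t) (τ p u w) := by
      rw [hs t v, hs w u]; simp
    have q2 : g p (τ p w v) (τ p t u) = g p (τ p u t) (τ p v w) := by
      rw [gs, hs w v, hs t u]; simp
    rw [q1, q2] at h1
    linarith
  -- Subtracting the same condition with `v` and `w` exchanged removes the derivatives along `v` and
  -- `w`.
  have cyc : ∀ u v w t, D u v w t = -D t u v w := by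
    intro u v w t
    have k1 := key u v w t
    have k2 := key u w v t
    have := t23 u v w t
    linarith [t12 u v w t, t12 u w v t, t23 v u w t, t12 v t u w, t23 v t u w, t12 w t u v,
      t23 w t u v, t12 w u t v, t12 v u t w, t12 t w u v, t23 t w u v, t12 t v u w, t23 t v u w,
      t23 t u v w, t12 w u v t, t23 w u v t]
  linarith [cyc u v w t, cyc v u w t, t12 t u v w]

variable [FiniteDimensional ℝ E]

theorem trace (h : ChartModel g S τ c p) {A : E → E → E → ℝ}
    (hA : ∀ z, IsBilinearMap ℝ (A z)) (hA' : ∀ u v, DifferentiableAt ℝ (fun z => A z u v) p) :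
    DifferentiableAt ℝ (fun z => ∑ a, A z (c z a) (c z a)) p ∧
      ∀ w, fderiv ℝ (fun z => ∑ a, A z (c z a) (c z a)) p w =
        ∑ a, chartCov₂ (S p) A p w (c p a) (c p a) :=
  trace_differentiable h.finrank_eq h.differentiable_g h.metric.self_of_nhds h.symm_g.self_of_nhds
    h.frame (.of_forall hA) hA'

/-- For fixed `u, v` the Ricci tensor is the trace of a bilinear form in the outer slots of the
curvature, so `trace` handles these slots. The Christoffel terms of `u` and `v` are subtracted on
both sides. -/
theorem ric_deriv (h : ChartModel g S τ c p) (u v : E) :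
    DifferentiableAt ℝ (fun z => chartRic g S c z u v) p ∧
      ∀ w, chartCov₂ (S p) (chartRic g S c) p w u v =
        ∑ a, g p (chartCovRm S p w (c p a) u v) (c p a) := by
  have hd : ∀ q r, DifferentiableAt ℝ (fun z => g z (chartRm S z q u v) r) p := fun q r =>
    differentiableAt_clm_apply₂ h.differentiable_g (differentiableAt_chartRm h.contDiff_S q u v).1
      (differentiableAt_const r)
  obtain ⟨h1, h2⟩ := h.trace (A := fun z q r => g z (chartRm S z q u v) r)
    (fun z => ⟨fun _ _ _ => by simp only [chartRm_add_left, map_add, add_apply],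
      fun _ _ _ => by simp only [chartRm_smul_left, map_smul, smul_apply],
      fun _ _ _ => map_add _ _ _, fun _ _ _ => map_smul _ _ _⟩) hd
  refine ⟨h1, fun w => ?_⟩
  have h3 := h2 w
  simp only [chartCov₂, chartRic] at h3 ⊢
  rw [h3, ← Finset.sum_sub_distrib, ← Finset.sum_sub_distrib]
  refine Finset.sum_congr rfl fun a _ => ?_
  rw [← inner_chartCovRm h.differentiable_g h.contDiff_S h.metric.self_of_nhds]
  ring

theorem scal_deriv (h : ChartModel g S τ c p) :
    DifferentiableAt ℝ (chartScal g S c) p ∧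
      ∀ w, fderiv ℝ (chartScal g S c) p w =
        ∑ i, chartCov₂ (S p) (chartRic g S c) p w (c p i) (c p i) :=
  h.trace isBilinearMap_ric fun u v => (h.ric_deriv u v).1

/-- The contracted second Bianchi identity. -/
theorem contracted_bianchi (h : ChartModel g S τ c p) (w : E) :
    fderiv ℝ (chartScal g S c) p w =
      2 * ∑ i, chartCov₂ (S p) (chartRic g S c) p (c p i) (c p i) w := by
  have hsymm : ∀ q u v, chartCov₂ (S p) (chartRic g S c) p q u v =
      chartCov₂ (S p) (chartRic g S c) p q v u := by
    intro q u v
    have e : (fun z => chartRic g S c z u v) =ᶠ[nhds p] fun z => chartRic g S c z v u := by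
      filter_upwards [h.eventually] with z hz using hz.ric_symm u v
    simp only [chartCov₂, e.fderiv_eq, h.ric_symm _ v, h.ric_symm u]
    ring
  rw [h.scal_deriv.2]
  simp only [hsymm _ _ w, (h.ric_deriv _ _).2]
  -- The second Bianchi identity, with skewness in both pairs used to reorder. Summed over `i` and
  -- `a`, each term on the right is the divergence of the Ricci tensor.
  have key : ∀ i a, g p (chartCovRm S p w (c p a) (c p i) (c p i)) (c p a) =
      g p (chartCovRm S p (c p a) (c p i) w (c p a)) (c p i)
        + g p (chartCovRm S p (c p i) (c p a) w (c p i)) (c p a) := by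
    intro i a
    have hb := chartCovRm_cyclic h.contDiff_S h.symm_S w (c p a) (c p i) (c p i)
    have hb' := congrArg (fun x => g p x (c p a)) hb
    simp only [map_add, add_apply, map_zero, zero_apply] at hb'
    rw [covRm_swap (c p i) w (c p a), map_neg, neg_apply,
      h.covRm_metric_skew (c p a) (c p i) w (c p i)] at hb'
    linarith
  simp only [key, Finset.sum_add_distrib]
  rw [Finset.sum_comm, two_mul]

/-- A double contraction: `trace` is applied to the inner sum, and the differentiability it provides
is what the outer application needs. -/
theorem sq_deriv (h : ChartModel g S τ c p) (u v : E) :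
    DifferentiableAt ℝ (fun z => chartSq (chartT g τ) c z u v) p ∧
      ∀ w, chartCov₂ (S p) (chartSq (chartT g τ) c) p w u v =
        ∑ a, ∑ b, (chartCov₃ (S p) (chartT g τ) p w u (c p a) (c p b)
            * chartT g τ p v (c p a) (c p b)
          + chartT g τ p u (c p a) (c p b)
            * chartCov₃ (S p) (chartT g τ) p w v (c p a) (c p b)) := by
  have hT := h.differentiable_T
  have inner := fun q q' => h.trace (A := fun z r r' => chartT g τ z u q r * chartT g τ z v q' r')
    (fun z => ⟨fun _ _ _ => by simp only [chartT, map_add, add_mul],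
      fun _ _ _ => by simp only [chartT, map_smul, smul_eq_mul, mul_assoc],
      fun _ _ _ => by simp only [chartT, map_add, mul_add],
      fun _ _ _ => by simp only [chartT, map_smul, smul_eq_mul, mul_left_comm]⟩)
    (fun r r' => (hT u q r).mul (hT v q' r'))
  obtain ⟨h1, h2⟩ := h.trace
    (A := fun z q q' => ∑ b, chartT g τ z u q (c z b) * chartT g τ z v q' (c z b))
    (fun z => ⟨fun _ _ _ => by
        simp only [chartT, map_add, add_apply, add_mul, Finset.sum_add_distrib],
      fun _ _ _ => by simp only [chartT, map_smul, smul_apply, smul_eq_mul, mul_assoc,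
        Finset.mul_sum],
      fun _ _ _ => by simp only [chartT, map_add, add_apply, mul_add, Finset.sum_add_distrib],
      fun _ _ _ => by simp only [chartT, map_smul, smul_apply, smul_eq_mul, mul_left_comm,
        Finset.mul_sum]⟩)
    (fun q q' => (inner q q').1)
  refine ⟨h1, fun w => ?_⟩
  have h3 := h2 w
  simp only [chartCov₂, chartSq] at h3 ⊢
  rw [h3, ← Finset.sum_sub_distrib, ← Finset.sum_sub_distrib]
  refine Finset.sum_congr rfl fun a _ => ?_
  rw [(inner _ _).2]
  simp only [chartCov₂]
  simp only [← Finset.sum_sub_distrib]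
  refine Finset.sum_congr rfl fun b _ => ?_
  rw [fderiv_fun_mul (hT _ _ _) (hT _ _ _)]
  simp only [chartCov₃, add_apply, smul_apply, smul_eq_mul]
  ring

theorem norm_deriv (h : ChartModel g S τ c p) :
    DifferentiableAt ℝ (chartNorm (chartT g τ) c) p ∧
      ∀ w, fderiv ℝ (chartNorm (chartT g τ) c) p w =
        2 * ∑ i, ∑ a, ∑ b, chartT g τ p (c p i) (c p a) (c p b)
          * chartCov₃ (S p) (chartT g τ) p w (c p i) (c p a) (c p b) := by
  obtain ⟨h1, h2⟩ := h.trace isBilinearMap_sq fun u v => (h.sq_deriv u v).1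
  refine ⟨h1, fun w => (h2 w).trans ?_⟩
  simp only [(h.sq_deriv _ _).2, Finset.mul_sum]
  refine Finset.sum_congr rfl fun i _ => Finset.sum_congr rfl fun a _ =>
    Finset.sum_congr rfl fun b _ => ?_
  ring

theorem scal_eq (h : ChartModel g S τ c p) :
    chartScal g S c p = chartScal g (fun z => S z + (1 / 2 : ℝ) • τ z) c p
      + 1 / 4 * chartNorm (chartT g τ) c p := by
  simp only [chartScal, chartNorm, Finset.mul_sum, ← Finset.sum_add_distrib]
  refine Finset.sum_congr rfl fun i _ => ?_
  linarith [h.ric_symm_part (c p i) (c p i)]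

/-- Near `p` this scalar curvature is the Riemannian one minus a quarter of the square norm of the
torsion, both already differentiated as traces. -/
theorem scal_torsion_differentiable (h : ChartModel g S τ c p) :
    DifferentiableAt ℝ (chartScal g (fun z => S z + (1 / 2 : ℝ) • τ z) c) p ∧
      ∀ w, fderiv ℝ (chartScal g S c) p w =
        fderiv ℝ (chartScal g (fun z => S z + (1 / 2 : ℝ) • τ z) c) p w
          + 1 / 4 * fderiv ℝ (chartNorm (chartT g τ) c) p w := by
  have e : chartScal g (fun z => S z + (1 / 2 : ℝ) • τ z) c =ᶠ[nhds p]
      fun z => chartScal g S c z - 1 / 4 * chartNorm (chartT g τ) c z := by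
    filter_upwards [h.eventually] with z hz using by rw [hz.scal_eq]; ring
  have hd := h.scal_deriv.1.hasFDerivAt.fun_sub
    (h.norm_deriv.1.hasFDerivAt.const_mul (1 / 4 : ℝ))
  have hd' := hd.congr_of_eventuallyEq e
  refine ⟨hd'.differentiableAt, fun w => ?_⟩
  rw [hd'.fderiv]
  simp

/-- The Einstein identity for a connection with skew torsion. -/
theorem einstein_identity (h : ChartModel g S τ c p) (hn : n ≠ 0)
    (hE : ∀ᶠ z in nhds p, ∃ lam : ℝ, ∀ u v,
      (chartRic g (fun z => S z + (1 / 2 : ℝ) • τ z) c z u v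
        + chartRic g (fun z => S z + (1 / 2 : ℝ) • τ z) c z v u) / 2 = lam * g z u v) (w : E) :
    ((n : ℝ) - 2) / n * fderiv ℝ (chartScal g (fun z => S z + (1 / 2 : ℝ) • τ z) c) p w
      - 1 / 2 * ∑ i, chartCov₂ (S p) (chartSq (chartT g τ) c) p (c p i) (c p i) w
      + 1 / 4 * fderiv ℝ (chartNorm (chartT g τ) c) p w = 0 := by
  have hn' : (n : ℝ) ≠ 0 := by exact_mod_cast hn
  set s := chartScal g (fun z => S z + (1 / 2 : ℝ) • τ z) c with hs
  -- The Einstein condition in Riemannian form. Replacing the factor `lam`, of unknown regularity,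
  -- by `s / n` makes the right-hand side differentiable.
  have e : ∀ u v, (fun z => chartRic g S c z u v) =ᶠ[nhds p]
      fun z => s z * (1 / n) * g z u v + 1 / 4 * chartSq (chartT g τ) c z u v := by
    intro u v
    filter_upwards [h.eventually, hE] with z hz ⟨lam, hlam⟩
    have hl : s z = lam * n := by
      have hd : ∀ i, chartRic g (fun z => S z + (1 / 2 : ℝ) • τ z) c z (c z i) (c z i) = lam := by
        intro i
        have := hlam (c z i) (c z i)
        rw [hz.frame.self_of_nhds i i, if_pos rfl] at this
        linarith
      simp only [hs, chartScal, hd]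
      simp [mul_comm]
    have h1 := hz.ric_symm_part u v
    have h2 := hz.ric_symm u v
    have h3 := hlam u v
    have h4 : s z * (1 / n) = lam := by rw [hl]; field_simp
    rw [h4]
    linarith
  have hg : ∀ u v, DifferentiableAt ℝ (fun z => g z u v) p := fun u v =>
    differentiableAt_clm_apply₂ h.differentiable_g (differentiableAt_const u)
      (differentiableAt_const v)
  have hsd := h.scal_torsion_differentiable.1
  have hcov : ∀ q u v, chartCov₂ (S p) (chartRic g S c) p q u v =
      fderiv ℝ s p q * (1 / n) * g p u v
        + 1 / 4 * chartCov₂ (S p) (chartSq (chartT g τ) c) p q u v := by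
    intro q u v
    have hd := ((hsd.hasFDerivAt.mul_const (1 / (n : ℝ))).fun_mul (hg u v).hasFDerivAt).fun_add
      ((h.sq_deriv u v).1.hasFDerivAt.const_mul (1 / 4 : ℝ))
    have e0 : ∀ u v, chartRic g S c p u v =
      s p * (1 / n) * g p u v + 1 / 4 * chartSq (chartT g τ) c p u v :=
      fun u v => (e u v).self_of_nhds
    simp only [chartCov₂]
    rw [(e u v).fderiv_eq, e0, e0, hd.fderiv, ← hs]
    simp only [add_apply, smul_apply, smul_eq_mul, fderiv_clm_apply_const₂ h.differentiable_g,
      h.metric.self_of_nhds]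
    ring
  -- As `g` is parallel, this becomes `d Scal + d‖T‖²/4 = 2 (d Scal/n + div T²/4)`.
  have hb := h.contracted_bianchi w
  rw [h.scal_torsion_differentiable.2 w] at hb
  simp only [hcov, Finset.sum_add_distrib, ← Finset.mul_sum] at hb
  have hx : ∑ i, fderiv ℝ s p (c p i) * (1 / n) * g p (c p i) w = fderiv ℝ s p w * (1 / n) := by
    conv_rhs => rw [h.frame.self_of_nhds.expand h.finrank_eq w]
    simp only [map_sum, map_smul, smul_eq_mul, Finset.sum_mul]
    refine Finset.sum_congr rfl fun i _ => ?_
    rw [h.symm_g.self_of_nhds w]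
    ring
  rw [hx] at hb
  have : ((n : ℝ) - 2) / n = 1 - 2 * (1 / n) := by field_simp
  rw [this]
  linarith

/-- The divergence of `T²` in terms of `θ`, `Θ` and `‖T‖²`. -/
theorem div_sq (h : ChartModel g S τ c p) (w : E) :
    ∑ s, chartCov₂ (S p) (chartSq (chartT g τ) c) p (c p s) (c p s) w =
      (∑ a, ∑ b, (∑ s, chartCov₃ (S p) (chartT g τ) p (c p s) (c p s) (c p a) (c p b))
        * chartT g τ p w (c p a) (c p b))
      + 1 / 6 * fderiv ℝ (chartNorm (chartT g τ) c) p w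
      - 1 / 3 * ∑ a, ∑ b, ∑ d, chartT g τ p (c p a) (c p b) (c p d) *
        (chartCov₃ (S p) (chartT g τ) p w (c p a) (c p b) (c p d)
          - chartCov₃ (S p) (chartT g τ) p (c p a) w (c p b) (c p d)
          + chartCov₃ (S p) (chartT g τ) p (c p b) w (c p a) (c p d)
          - chartCov₃ (S p) (chartT g τ) p (c p d) w (c p a) (c p b)) := by
  set b := c p
  set T := chartT g τ p
  set D := chartCov₃ (S p) (chartT g τ) p
  have t12 : ∀ u v w, T u v w = -T v u w := h.T_swap₁₂
  have t23 : ∀ u v w, T u v w = -T u w v := h.T_swap₂₃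
  -- Leibniz rule: one half is the divergence of `T` paired with `T`, the other is `X_w = ∑ T(s,a,d)
  -- (∇ᵍ_s T)(w,a,d)`.
  have e1 : ∑ s, chartCov₂ (S p) (chartSq (chartT g τ) c) p (b s) (b s) w =
      (∑ a, ∑ d, (∑ s, D (b s) (b s) (b a) (b d)) * T w (b a) (b d))
        + ∑ s, ∑ a, ∑ d, T (b s) (b a) (b d) * D (b s) w (b a) (b d) := by
    simp only [(h.sq_deriv _ _).2, Finset.sum_add_distrib]
    congr 1
    rw [Finset.sum_comm]
    refine Finset.sum_congr rfl fun a _ => ?_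
    rw [Finset.sum_comm]
    exact Finset.sum_congr rfl fun d _ => by rw [Finset.sum_mul]
  -- By skewness of `T` each of the last three terms of the contraction of `dT` with `T` equals
  -- `-X`. The contraction is therefore `d‖T‖²/2 - 3X`, whence the coefficients `1/6` and `1/3`.
  have e2 : ∑ a, ∑ d, ∑ e, T (b a) (b d) (b e) * D (b d) w (b a) (b e) =
      -∑ s, ∑ a, ∑ d, T (b s) (b a) (b d) * D (b s) w (b a) (b d) := by
    rw [Finset.sum_comm]
    simp only [← Finset.sum_neg_distrib]
    exact Finset.sum_congr rfl fun d _ => Finset.sum_congr rfl fun a _ =>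
      Finset.sum_congr rfl fun e _ => by rw [t12]; ring
  have e3 : ∑ a, ∑ d, ∑ e, T (b a) (b d) (b e) * D (b e) w (b a) (b d) =
      ∑ s, ∑ a, ∑ d, T (b s) (b a) (b d) * D (b s) w (b a) (b d) := by
    have : ∀ a, ∑ d, ∑ e, T (b a) (b d) (b e) * D (b e) w (b a) (b d) =
      ∑ e, ∑ d, T (b a) (b d) (b e) * D (b e) w (b a) (b d) := fun a => Finset.sum_comm
    simp only [this]
    rw [Finset.sum_comm]
    exact Finset.sum_congr rfl fun d _ => Finset.sum_congr rfl fun a _ =>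
      Finset.sum_congr rfl fun e _ => by rw [t23, t12]; ring
  rw [e1, h.norm_deriv.2]
  simp only [mul_add, mul_sub, Finset.sum_add_distrib, Finset.sum_sub_distrib, e2, e3]
  ring

/-- With `∇ᵍT` totally skew, the half containing the divergence of `T` repeats an argument and
vanishes. In the other half, exchanging the direction of differentiation with `w` gives `-⟨T, ∇ᵍ_w
T⟩`. -/
theorem div_sq_of_pair_symm (h : ChartModel g S τ c p)
    (hR : ∀ u v w t, g p (chartRm (fun z => S z + (1 / 2 : ℝ) • τ z) p u v w) t =
      g p (chartRm (fun z => S z + (1 / 2 : ℝ) • τ z) p w t u) v) (w : E) :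
    ∑ s, chartCov₂ (S p) (chartSq (chartT g τ) c) p (c p s) (c p s) w =
      -(1 / 2 * fderiv ℝ (chartNorm (chartT g τ) c) p w) := by
  have hD := h.cov_T_swap_of_pair_symm hR
  rw [h.norm_deriv.2]
  simp only [(h.sq_deriv _ _).2, Finset.mul_sum, ← Finset.sum_neg_distrib]
  refine Finset.sum_congr rfl fun i _ => Finset.sum_congr rfl fun a _ =>
    Finset.sum_congr rfl fun b _ => ?_
  have : chartCov₃ (S p) (chartT g τ) p (c p i) (c p i) (c p a) (c p b) = 0 := by
    linarith [hD (c p i) (c p i) (c p a) (c p b)]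
  rw [this, hD (c p i) w]
  ring

end ChartModel

/-! ### Vector fields and Lie brackets in a chart -/

section Coordinates

variable {n : ℕ} {M : Type*} [TopologicalSpace M] [ChartedSpace (EuclideanSpace ℝ (Fin n)) M]
  {x y : M}

theorem symm_mem_source {z : EuclideanSpace ℝ (Fin n)} (hz : z ∈ (extChartAt (𝓡 n) x).target) :
    (extChartAt (𝓡 n) x).symm z ∈ (extChartAt (𝓡 n) x).source :=
  (extChartAt (𝓡 n) x).map_target hz

theorem eventually_mem_target (hy : y ∈ (extChartAt (𝓡 n) x).source) :
    ∀ᶠ z in nhds (extChartAt (𝓡 n) x y), z ∈ (extChartAt (𝓡 n) x).target :=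
  (isOpen_extChartAt_target x).mem_nhds ((extChartAt (𝓡 n) x).map_source hy)

variable [IsManifold (𝓡 n) ∞ M]

/-- The coordinates at `y` of a tangent vector, in the chart at `x`. -/
noncomputable def coord (x y : M) : TangentSpace (𝓡 n) y →L[ℝ] EuclideanSpace ℝ (Fin n) :=
  (trivializationAt (EuclideanSpace ℝ (Fin n)) (fun x : M => TangentSpace (𝓡 n) x)
    x).continuousLinearMapAt ℝ y

/-- The tangent vector at `y` with given coordinates in the chart at `x`. -/
noncomputable def coordSymm (x y : M) : EuclideanSpace ℝ (Fin n) →L[ℝ] TangentSpace (𝓡 n) y :=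
  (trivializationAt (EuclideanSpace ℝ (Fin n)) (fun x : M => TangentSpace (𝓡 n) x)
    x).symmL ℝ y

/-- The coordinate expression of a vector field in the chart at `x`. -/
noncomputable def rep (x : M) (Y : Π y : M, TangentSpace (𝓡 n) y) (z : EuclideanSpace ℝ (Fin n)) :
    EuclideanSpace ℝ (Fin n) :=
  coord x ((extChartAt (𝓡 n) x).symm z) (Y ((extChartAt (𝓡 n) x).symm z))

/-- The vector field with constant coefficients in the chart at `x`. -/
noncomputable def constField (x : M) (u : EuclideanSpace ℝ (Fin n)) :
    Π y : M, TangentSpace (𝓡 n) y :=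
  fun y => coordSymm x y u

theorem mem_baseSet_of_mem_source (hy : y ∈ (extChartAt (𝓡 n) x).source) :
    y ∈ (trivializationAt (EuclideanSpace ℝ (Fin n)) (fun x : M => TangentSpace (𝓡 n) x)
      x).baseSet := by
  simpa using hy

theorem coord_coordSymm (hy : y ∈ (extChartAt (𝓡 n) x).source) (u : EuclideanSpace ℝ (Fin n)) :
    coord x y (coordSymm x y u) = u :=
  Bundle.Trivialization.continuousLinearMapAt_symmL _ (mem_baseSet_of_mem_source hy) u

theorem coordSymm_coord (hy : y ∈ (extChartAt (𝓡 n) x).source) (v : TangentSpace (𝓡 n) y) :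
    coordSymm x y (coord x y v) = v :=
  Bundle.Trivialization.symmL_continuousLinearMapAt _ (mem_baseSet_of_mem_source hy) v

theorem ext_eq_constField (u : TangentSpace (𝓡 n) x) (hy : y ∈ (extChartAt (𝓡 n) x).source) :
    ext u y = constField x (coord x x u) y := by
  have hx := mem_baseSet_of_mem_source (mem_extChartAt_source (I := 𝓡 n) x)
  rw [constField, coordSymm, coord, Bundle.Trivialization.continuousLinearMapAt_apply_of_mem _ _ hx,
    Bundle.Trivialization.symmL_apply _ (mem_baseSet_of_mem_source hy)]
  rfl

theorem mfderiv_extChartAt_eq_coord (hy : y ∈ (extChartAt (𝓡 n) x).source) :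
    mfderiv (𝓡 n) 𝓘(ℝ, EuclideanSpace ℝ (Fin n)) (extChartAt (𝓡 n) x) y = coord x y :=
  (TangentBundle.continuousLinearMapAt_trivializationAt (by simpa using hy)).symm

theorem mfderiv_extChartAt_symm_eq (hy : y ∈ (extChartAt (𝓡 n) x).source) :
    mfderiv 𝓘(ℝ, EuclideanSpace ℝ (Fin n)) (𝓡 n) (extChartAt (𝓡 n) x).symm
      (extChartAt (𝓡 n) x y) = coordSymm x y := by
  have := TangentBundle.symmL_trivializationAt (I := 𝓡 n) (x₀ := x) (x := y) (by simpa using hy)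
  rw [ModelWithCorners.Boundaryless.range_eq_univ, mfderivWithin_univ] at this
  exact this.symm

theorem contMDiffAt_symm (hy : y ∈ (extChartAt (𝓡 n) x).source) :
    ContMDiffAt 𝓘(ℝ, EuclideanSpace ℝ (Fin n)) (𝓡 n) ∞ (extChartAt (𝓡 n) x).symm
      (extChartAt (𝓡 n) x y) :=
  (contMDiffOn_extChartAt_symm x).contMDiffAt (eventually_mem_target hy)

theorem contMDiffAt_chart (hy : y ∈ (extChartAt (𝓡 n) x).source) :
    ContMDiffAt (𝓡 n) 𝓘(ℝ, EuclideanSpace ℝ (Fin n)) ∞ (extChartAt (𝓡 n) x) y :=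
  contMDiffAt_extChartAt' (by simpa using hy)

theorem hasMFDerivAt_of_comp_symm {F : Type*} [NormedAddCommGroup F] [NormedSpace ℝ F] {f : M → F}
    {L : EuclideanSpace ℝ (Fin n) →L[ℝ] F} (hy : y ∈ (extChartAt (𝓡 n) x).source)
    (hf : HasFDerivAt (fun z => f ((extChartAt (𝓡 n) x).symm z)) L (extChartAt (𝓡 n) x y)) :
    HasMFDerivAt (𝓡 n) 𝓘(ℝ, F) f y (L ∘L coord x y) := by
  have h1 := hf.hasMFDerivAt
  have h2 : HasMFDerivAt (𝓡 n) 𝓘(ℝ, EuclideanSpace ℝ (Fin n)) (extChartAt (𝓡 n) x) y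
      (coord x y) := by
    rw [← mfderiv_extChartAt_eq_coord hy]
    exact ((contMDiffAt_chart hy).mdifferentiableAt (by simp)).hasMFDerivAt
  refine (HasMFDerivAt.comp y h1 h2).congr_of_eventuallyEq ?_
  filter_upwards [extChartAt_source_mem_nhds' (I := 𝓡 n) hy] with y' hy'
  change f y' = f ((extChartAt (𝓡 n) x).symm (extChartAt (𝓡 n) x y'))
  rw [(extChartAt (𝓡 n) x).left_inv hy']

theorem mvfderiv_eq_of_comp_symm {f : M → ℝ} (hy : y ∈ (extChartAt (𝓡 n) x).source)
    (hf : DifferentiableAt ℝ (fun z => f ((extChartAt (𝓡 n) x).symm z)) (extChartAt (𝓡 n) x y))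
    (v : TangentSpace (𝓡 n) y) :
    mvfderiv (𝓡 n) f y v =
      fderiv ℝ (fun z => f ((extChartAt (𝓡 n) x).symm z)) (extChartAt (𝓡 n) x y) (coord x y v) := by
  rw [mvfderiv, (hasMFDerivAt_of_comp_symm hy hf.hasFDerivAt).mfderiv]
  rfl

theorem mdifferentiableAt_iff_rep {Y : Π y : M, TangentSpace (𝓡 n) y}
    (hy : y ∈ (extChartAt (𝓡 n) x).source) :
    MDifferentiableAt (𝓡 n) ((𝓡 n).prod 𝓘(ℝ, EuclideanSpace ℝ (Fin n)))
      (fun y => Bundle.TotalSpace.mk' (EuclideanSpace ℝ (Fin n)) y (Y y)) y ↔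
      DifferentiableAt ℝ (rep x Y) (extChartAt (𝓡 n) x y) := by
  rw [Bundle.Trivialization.mdifferentiableAt_section_iff (𝓡 n)
    (trivializationAt (EuclideanSpace ℝ (Fin n)) (fun x : M => TangentSpace (𝓡 n) x) x) Y
    (mem_baseSet_of_mem_source hy)]
  have e : (fun y => (trivializationAt (EuclideanSpace ℝ (Fin n))
      (fun x : M => TangentSpace (𝓡 n) x) x ⟨y, Y y⟩).2) =ᶠ[nhds y] fun y => coord x y (Y y) := by
    filter_upwards [extChartAt_source_mem_nhds' (I := 𝓡 n) hy] with y' hy'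
    rw [coord, Bundle.Trivialization.continuousLinearMapAt_apply_of_mem _ _
      (mem_baseSet_of_mem_source hy')]
  rw [e.mdifferentiableAt_iff]
  constructor
  · intro h
    rw [← mdifferentiableAt_iff_differentiableAt]
    have h' := h
    rw [← (extChartAt (𝓡 n) x).left_inv hy] at h'
    exact h'.comp (extChartAt (𝓡 n) x y) ((contMDiffAt_symm hy).mdifferentiableAt (by simp))
  · intro h
    exact (hasMFDerivAt_of_comp_symm hy h.hasFDerivAt).mdifferentiableAt

theorem contDiffAt_rep {Y : Π y : M, TangentSpace (𝓡 n) y} {k : ℕ∞ω} (hk : k ≤ ∞)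
    (hy : y ∈ (extChartAt (𝓡 n) x).source)
    (hY : ContMDiffAt (𝓡 n) ((𝓡 n).prod 𝓘(ℝ, EuclideanSpace ℝ (Fin n))) k
      (fun y => Bundle.TotalSpace.mk' (EuclideanSpace ℝ (Fin n)) y (Y y)) y) :
    ContDiffAt ℝ k (rep x Y) (extChartAt (𝓡 n) x y) := by
  have : IsManifold (𝓡 n) (k + 1) M := .of_le (n := ∞) (by
    calc k + 1 ≤ ∞ + 1 := by gcongr
      _ = ∞ := rfl)
  have : ContMDiffVectorBundle k (EuclideanSpace ℝ (Fin n))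
      (fun x : M => TangentSpace (𝓡 n) x) (𝓡 n) := TangentBundle.contMDiffVectorBundle
  rw [Bundle.Trivialization.contMDiffAt_section_iff
    (trivializationAt (EuclideanSpace ℝ (Fin n)) (fun x : M => TangentSpace (𝓡 n) x) x)
    (mem_baseSet_of_mem_source hy)] at hY
  have e : (fun y => (trivializationAt (EuclideanSpace ℝ (Fin n))
      (fun x : M => TangentSpace (𝓡 n) x) x ⟨y, Y y⟩).2) =ᶠ[nhds y] fun y => coord x y (Y y) := by
    filter_upwards [extChartAt_source_mem_nhds' (I := 𝓡 n) hy] with y' hy'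
    rw [coord, Bundle.Trivialization.continuousLinearMapAt_apply_of_mem _ _
      (mem_baseSet_of_mem_source hy')]
  have hY' := hY.congr_of_eventuallyEq e.symm
  rw [← contMDiffAt_iff_contDiffAt]
  rw [← (extChartAt (𝓡 n) x).left_inv hy] at hY'
  exact hY'.comp (extChartAt (𝓡 n) x y) ((contMDiffAt_symm hy).of_le hk)

theorem rep_constField_eventuallyEq (hy : y ∈ (extChartAt (𝓡 n) x).source)
    (u : EuclideanSpace ℝ (Fin n)) :
    rep x (constField x u) =ᶠ[nhds (extChartAt (𝓡 n) x y)] fun _ => u := by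
  filter_upwards [eventually_mem_target hy] with z hz
  exact coord_coordSymm (symm_mem_source hz) u

theorem mdifferentiableAt_constField (hy : y ∈ (extChartAt (𝓡 n) x).source)
    (u : EuclideanSpace ℝ (Fin n)) :
    MDifferentiableAt (𝓡 n) ((𝓡 n).prod 𝓘(ℝ, EuclideanSpace ℝ (Fin n)))
      (fun y => Bundle.TotalSpace.mk' (EuclideanSpace ℝ (Fin n)) y (constField x u y)) y := by
  rw [mdifferentiableAt_iff_rep hy]
  exact (differentiableAt_const u).congr_of_eventuallyEq (rep_constField_eventuallyEq hy u)

/-- Naturality of the bracket under pullback along the inverse chart: the inverse of its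
differential is `coord`, so the pullback of a field is its coordinate expression. -/
theorem coord_mlieBracket {X Y : Π y : M, TangentSpace (𝓡 n) y}
    (hy : y ∈ (extChartAt (𝓡 n) x).source)
    (hX : DifferentiableAt ℝ (rep x X) (extChartAt (𝓡 n) x y))
    (hY : DifferentiableAt ℝ (rep x Y) (extChartAt (𝓡 n) x y)) :
    coord x y (VectorField.mlieBracket (𝓡 n) X Y y) =
      fderiv ℝ (rep x Y) (extChartAt (𝓡 n) x y) (rep x X (extChartAt (𝓡 n) x y))
        - fderiv ℝ (rep x X) (extChartAt (𝓡 n) x y) (rep x Y (extChartAt (𝓡 n) x y)) := by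
  have hl := (extChartAt (𝓡 n) x).left_inv hy
  have hX' := (mdifferentiableAt_iff_rep hy).2 hX
  have hY' := (mdifferentiableAt_iff_rep hy).2 hY
  rw [← hl] at hX' hY'
  have hle : minSmoothness ℝ 2 ≤ ∞ := by
    rw [minSmoothness_of_isRCLikeNormedField]
    exact WithTop.coe_le_coe.2 le_top
  have : IsManifold (𝓡 n) (minSmoothness ℝ 2) M := .of_le (n := ∞) hle
  have key := VectorField.mpullback_mlieBracket hX' hY' (contMDiffAt_symm hy) hle
  have hinv : ∀ y ∈ (extChartAt (𝓡 n) x).source,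
      (mfderiv 𝓘(ℝ, EuclideanSpace ℝ (Fin n)) (𝓡 n) (extChartAt (𝓡 n) x).symm
        (extChartAt (𝓡 n) x y)).inverse = coord x y := by
    intro y hy
    rw [mfderiv_extChartAt_symm_eq hy]
    exact ContinuousLinearMap.inverse_eq (ContinuousLinearMap.ext fun v => coordSymm_coord hy v)
      (ContinuousLinearMap.ext fun v => coord_coordSymm hy v)
  have hpb : ∀ Y : Π y : M, TangentSpace (𝓡 n) y,
      VectorField.mpullback 𝓘(ℝ, EuclideanSpace ℝ (Fin n)) (𝓡 n) (extChartAt (𝓡 n) x).symm Y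
        =ᶠ[nhds (extChartAt (𝓡 n) x y)] rep x Y := by
    intro Y
    filter_upwards [eventually_mem_target hy] with z hz
    have := hinv _ (symm_mem_source hz)
    rw [(extChartAt (𝓡 n) x).right_inv hz] at this
    rw [VectorField.mpullback_apply, this]
    rfl
  rw [(hpb X).mlieBracket_vectorField_eq (hpb Y), (hpb _).self_of_nhds, rep, hl] at key
  refine key.trans ?_
  have hbr := congrFun (VectorField.mlieBracketWithin_eq_lieBracketWithin (𝕜 := ℝ)
    (V := rep x X) (W := rep x Y) (s := Set.univ)) (extChartAt (𝓡 n) x y)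
  rw [VectorField.lieBracketWithin_univ] at hbr
  refine Eq.trans ?_ hbr
  exact (congrFun (VectorField.mlieBracketWithin_univ (I := 𝓘(ℝ, EuclideanSpace ℝ (Fin n)))
    (V := rep x X) (W := rep x Y)) (extChartAt (𝓡 n) x y)).symm

end Coordinates

/-! ### Christoffel symbols, curvature and torsion of a connection in a chart -/

section Christoffel

variable {n : ℕ} {M : Type*} [TopologicalSpace M] [ChartedSpace (EuclideanSpace ℝ (Fin n)) M]
  [IsManifold (𝓡 n) ∞ M]

/-- The derivatives of the `k`-th coordinate vector field, in the chart at `x`. -/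
noncomputable def chrAux (nabla : Connection n M) (x : M) (z : EuclideanSpace ℝ (Fin n))
    (k : Fin n) : EuclideanSpace ℝ (Fin n) →L[ℝ] EuclideanSpace ℝ (Fin n) :=
  coord x ((extChartAt (𝓡 n) x).symm z) ∘L
    nabla (constField x (EuclideanSpace.single k 1)) ((extChartAt (𝓡 n) x).symm z) ∘L
    coordSymm x ((extChartAt (𝓡 n) x).symm z)

/-- The Christoffel symbol of a connection in the chart at `x`. -/
noncomputable def chr (nabla : Connection n M) (x : M) (z : EuclideanSpace ℝ (Fin n)) :
    EuclideanSpace ℝ (Fin n) →L[ℝ] EuclideanSpace ℝ (Fin n) →L[ℝ] EuclideanSpace ℝ (Fin n) :=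
  (∑ k, (EuclideanSpace.proj k : EuclideanSpace ℝ (Fin n) →L[ℝ] ℝ).smulRight
    (chrAux nabla x z k)).flip

variable {nabla : Connection n M} {x y : M}

theorem chr_apply (z u w : EuclideanSpace ℝ (Fin n)) :
    chr nabla x z u w = ∑ k, w k • chrAux nabla x z k u := by
  simp [chr]

theorem sum_smul_single (w : EuclideanSpace ℝ (Fin n)) :
    ∑ k, w k • EuclideanSpace.single k (1 : ℝ) = w := by
  simpa using (EuclideanSpace.basisFun (Fin n) ℝ).sum_repr w

theorem connection_sum (s : Finset (Fin n)) (Y : Fin n → Π y : M, TangentSpace (𝓡 n) y)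
    (hY : ∀ k, MDifferentiableAt (𝓡 n) ((𝓡 n).prod 𝓘(ℝ, EuclideanSpace ℝ (Fin n)))
      (fun y => Bundle.TotalSpace.mk' (EuclideanSpace ℝ (Fin n)) y (Y k y)) y) :
    nabla (fun y => ∑ k ∈ s, Y k y) y = ∑ k ∈ s, nabla (Y k) y := by
  classical
  induction s using Finset.induction_on with
  | empty =>
    have h : nabla 0 y = 0 := congrFun nabla.zero y
    exact h
  | insert k s hk ih =>
    rw [Finset.sum_insert hk, ← ih]
    have := nabla.isCovariantDerivativeOnUniv.add (hY k)
      (MDifferentiableAt.sum_section (s := s) fun i _ => hY i)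
    rw [← this]
    congr 1
    funext y
    exact Finset.sum_insert hk

/-- Locally the field is a combination of coordinate fields. By locality and the Leibniz rule, the
derivatives of the coefficients give the `fderiv` term and the derivatives of the coordinate fields
give `chr`. -/
theorem coord_connection {Y : Π y : M, TangentSpace (𝓡 n) y}
    (hy : y ∈ (extChartAt (𝓡 n) x).source)
    (hY : DifferentiableAt ℝ (rep x Y) (extChartAt (𝓡 n) x y)) (v : TangentSpace (𝓡 n) y) :
    coord x y (nabla Y y v) = fderiv ℝ (rep x Y) (extChartAt (𝓡 n) x y) (coord x y v)
      + chr nabla x (extChartAt (𝓡 n) x y) (coord x y v) (rep x Y (extChartAt (𝓡 n) x y)) := by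
  set p := extChartAt (𝓡 n) x y with hp
  have hl : (extChartAt (𝓡 n) x).symm p = y := (extChartAt (𝓡 n) x).left_inv hy
  let f : Fin n → M → ℝ := fun k y => coord x y (Y y) k
  have hfd : ∀ k, HasFDerivAt (fun z => f k ((extChartAt (𝓡 n) x).symm z))
      ((EuclideanSpace.proj k : EuclideanSpace ℝ (Fin n) →L[ℝ] ℝ) ∘L fderiv ℝ (rep x Y) p) p :=
    fun k => (EuclideanSpace.proj k : EuclideanSpace ℝ (Fin n) →L[ℝ] ℝ).hasFDerivAt.comp p
      hY.hasFDerivAt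
  have hf : ∀ k, MDifferentiableAt (𝓡 n) 𝓘(ℝ, ℝ) (f k) y :=
    fun k => (hasMFDerivAt_of_comp_symm hy (hfd k)).mdifferentiableAt
  have hc := fun k => mdifferentiableAt_constField hy (EuclideanSpace.single k (1 : ℝ))
  have hYm := (mdifferentiableAt_iff_rep hy).2 hY
  have hfc := fun k => (hf k).smul_section (hc k)
  have heq : ∀ᶠ y' in nhds y,
      Y y' = ∑ k, f k y' • constField x (EuclideanSpace.single k 1) y' := by
    filter_upwards [extChartAt_source_mem_nhds' (I := 𝓡 n) hy] with y' hy'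
    simp only [constField, ← map_smul, ← map_sum]
    rw [sum_smul_single, coordSymm_coord hy']
  rw [nabla.isCovariantDerivativeOnUniv.congr_of_eventuallyEq hYm
    (MDifferentiableAt.sum_section (s := Finset.univ) fun k _ => hfc k) Filter.univ_mem heq,
    connection_sum _ (fun k => f k • constField x (EuclideanSpace.single k 1)) hfc]
  have hlz : ∀ k, nabla (f k • constField x (EuclideanSpace.single k 1)) y =
      f k y • nabla (constField x (EuclideanSpace.single k 1)) y
        + (mvfderiv (𝓡 n) (f k) y).smulRight (constField x (EuclideanSpace.single k 1) y) :=
    fun k => nabla.isCovariantDerivativeOnUniv.leibniz (hc k) (hf k)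
  have hd : ∀ k, mvfderiv (𝓡 n) (f k) y v = (fderiv ℝ (rep x Y) p (coord x y v)) k := by
    intro k
    rw [mvfderiv_eq_of_comp_symm hy (hfd k).differentiableAt, (hfd k).fderiv]
    rfl
  have hA : ∀ k, coord x y (nabla (constField x (EuclideanSpace.single k 1)) y v)
      = chrAux nabla x p k (coord x y v) := by
    intro k
    simp only [chrAux, ContinuousLinearMap.comp_apply]
    rw [hl, coordSymm_coord hy]
  have hrep : rep x Y p = coord x y (Y y) := by rw [rep, hl]
  simp only [hlz, sum_apply, add_apply, map_sum, map_add, smul_apply,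
    map_smul, hA, ContinuousLinearMap.smulRight_apply, hd, Finset.sum_add_distrib]
  rw [chr_apply, hrep, add_comm]
  congr 1
  rw [← sum_smul_single (fderiv ℝ (rep x Y) p (coord x y v))]
  refine Finset.sum_congr rfl fun k _ => ?_
  rw [constField, coord_coordSymm hy, sum_smul_single]

theorem rep_connection {Y : Π y : M, TangentSpace (𝓡 n) y} (X : Π y : M, TangentSpace (𝓡 n) y)
    {z : EuclideanSpace ℝ (Fin n)} (hz : z ∈ (extChartAt (𝓡 n) x).target)
    (hY : DifferentiableAt ℝ (rep x Y) z) :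
    rep x (fun y => nabla Y y (X y)) z =
      fderiv ℝ (rep x Y) z (rep x X z) + chr nabla x z (rep x X z) (rep x Y z) := by
  have hr := (extChartAt (𝓡 n) x).right_inv hz
  have := coord_connection (nabla := nabla) (Y := Y) (symm_mem_source hz) (by rwa [hr])
    (X ((extChartAt (𝓡 n) x).symm z))
  rw [hr] at this
  exact this

/-- The fields are arbitrary because the curvature at a point `y` near `x` is defined with
extensions that are constant in the chart at `y`, not at `x`. Only their values at `y` survive:
second derivatives of `Z` cancel by symmetry, first derivatives of `X` and `Y` against the bracket
term. -/
theorem coord_curvatureField {X Y Z : Π y : M, TangentSpace (𝓡 n) y}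
    (hy : y ∈ (extChartAt (𝓡 n) x).source)
    (hΓ : DifferentiableAt ℝ (chr nabla x) (extChartAt (𝓡 n) x y))
    (hX : DifferentiableAt ℝ (rep x X) (extChartAt (𝓡 n) x y))
    (hY : DifferentiableAt ℝ (rep x Y) (extChartAt (𝓡 n) x y))
    (hZ : ContDiffAt ℝ 2 (rep x Z) (extChartAt (𝓡 n) x y)) :
    coord x y (curvatureField nabla X Y Z y) = chartRm (chr nabla x) (extChartAt (𝓡 n) x y)
      (rep x X (extChartAt (𝓡 n) x y)) (rep x Y (extChartAt (𝓡 n) x y))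
      (rep x Z (extChartAt (𝓡 n) x y)) := by
  set p := extChartAt (𝓡 n) x y with hp
  have hl : (extChartAt (𝓡 n) x).symm p = y := (extChartAt (𝓡 n) x).left_inv hy
  have hZ1 : DifferentiableAt ℝ (rep x Z) p := hZ.differentiableAt (by norm_num)
  have hdZ : DifferentiableAt ℝ (fderiv ℝ (rep x Z)) p :=
    SkewTorsion.ContDiffAt.differentiableAt_fderiv hZ
  have hZe : ∀ᶠ z in nhds p, DifferentiableAt ℝ (rep x Z) z := by
    filter_upwards [hZ.eventually (by norm_num)] with z hz using hz.differentiableAt (by norm_num)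
  have hcoord : ∀ W : Π y : M, TangentSpace (𝓡 n) y, coord x y (W y) = rep x W p := by
    intro W
    rw [rep, hl]
  have main : ∀ X Y : Π y : M, TangentSpace (𝓡 n) y, DifferentiableAt ℝ (rep x Y) p →
      coord x y (nabla (fun y => nabla Z y (Y y)) y (X y)) =
        fderiv ℝ (fderiv ℝ (rep x Z)) p (rep x X p) (rep x Y p)
        + fderiv ℝ (rep x Z) p (fderiv ℝ (rep x Y) p (rep x X p))
        + (fderiv ℝ (chr nabla x) p (rep x X p) (rep x Y p) (rep x Z p)
          + chr nabla x p (fderiv ℝ (rep x Y) p (rep x X p)) (rep x Z p)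
          + chr nabla x p (rep x Y p) (fderiv ℝ (rep x Z) p (rep x X p)))
        + chr nabla x p (rep x X p)
          (fderiv ℝ (rep x Z) p (rep x Y p) + chr nabla x p (rep x Y p) (rep x Z p)) := by
    intro X Y hY
    have he : rep x (fun y => nabla Z y (Y y)) =ᶠ[nhds p] fun z =>
        fderiv ℝ (rep x Z) z (rep x Y z) + chr nabla x z (rep x Y z) (rep x Z z) := by
      filter_upwards [hZe, eventually_mem_target hy] with z h1 h2
      exact rep_connection Y h2 h1
    have d1 : DifferentiableAt ℝ (fun z => fderiv ℝ (rep x Z) z (rep x Y z)) p := hdZ.clm_apply hY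
    have d2 := differentiableAt_clm_apply₂ hΓ hY hZ1
    rw [coord_connection hy ((d1.fun_add d2).congr_of_eventuallyEq he), hcoord X, he.fderiv_eq,
      he.self_of_nhds, fderiv_fun_add d1 d2, add_apply, fderiv_clm_apply₂ hΓ hY hZ1,
      (hdZ.hasFDerivAt.clm_apply hY.hasFDerivAt).fderiv]
    simp only [add_apply, ContinuousLinearMap.comp_apply, ContinuousLinearMap.flip_apply]
    abel
  have hsymm : fderiv ℝ (fderiv ℝ (rep x Z)) p (rep x X p) (rep x Y p)
      = fderiv ℝ (fderiv ℝ (rep x Z)) p (rep x Y p) (rep x X p) :=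
    (hZ.isSymmSndFDerivAt (by simp)).eq _ _
  rw [curvatureField, map_sub, map_sub, main X Y hY, main Y X hX, coord_connection hy hZ1,
    coord_mlieBracket hy hX hY, hsymm, chartRm]
  simp only [map_add, map_sub, sub_apply]
  abel

theorem contDiffAt_rep_ext (hy : y ∈ (extChartAt (𝓡 n) x).source) (u : TangentSpace (𝓡 n) y) :
    ContDiffAt ℝ 2 (rep x (ext u)) (extChartAt (𝓡 n) x y) :=
  contDiffAt_rep (WithTop.coe_le_coe.2 le_top) hy
    ((FiberBundle.contMDiffAt_extend (k := ∞) (𝓡 n) (EuclideanSpace ℝ (Fin n)) u).of_le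
      (WithTop.coe_le_coe.2 le_top))

theorem rep_ext (hy : y ∈ (extChartAt (𝓡 n) x).source) (u : TangentSpace (𝓡 n) y) :
    rep x (ext u) (extChartAt (𝓡 n) x y) = coord x y u := by
  rw [rep, (extChartAt (𝓡 n) x).left_inv hy]
  exact congrArg _ (FiberBundle.extend_apply_self (EuclideanSpace ℝ (Fin n)) u)

theorem coord_curvature (hy : y ∈ (extChartAt (𝓡 n) x).source)
    (hΓ : DifferentiableAt ℝ (chr nabla x) (extChartAt (𝓡 n) x y)) (u v w : TangentSpace (𝓡 n) y) :
    coord x y (curvature nabla y u v w) = chartRm (chr nabla x) (extChartAt (𝓡 n) x y)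
      (coord x y u) (coord x y v) (coord x y w) := by
  rw [curvature, coord_curvatureField hy hΓ
    ((contDiffAt_rep_ext hy u).differentiableAt (by norm_num))
    ((contDiffAt_rep_ext hy v).differentiableAt (by norm_num)) (contDiffAt_rep_ext hy w),
    rep_ext hy, rep_ext hy, rep_ext hy]

theorem rep_ext_eventuallyEq (u : TangentSpace (𝓡 n) x) :
    rep x (ext u) =ᶠ[nhds (extChartAt (𝓡 n) x x)] fun _ => coord x x u := by
  filter_upwards [eventually_mem_target (mem_extChartAt_source (I := 𝓡 n) x)] with z hz
  rw [rep, ext_eq_constField _ (symm_mem_source hz), constField,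
    coord_coordSymm (symm_mem_source hz)]

theorem coord_connection_ext (u v : TangentSpace (𝓡 n) x) :
    coord x x (nabla (ext u) x v)
      = chr nabla x (extChartAt (𝓡 n) x x) (coord x x v) (coord x x u) := by
  have hx := mem_extChartAt_source (I := 𝓡 n) x
  rw [coord_connection hx ((contDiffAt_rep_ext hx u).differentiableAt (by norm_num)),
    (rep_ext_eventuallyEq u).fderiv_eq, rep_ext hx]
  simp

theorem mlieBracket_ext (u v : TangentSpace (𝓡 n) x) :
    VectorField.mlieBracket (𝓡 n) (ext u) (ext v) x = 0 := by
  have hx := mem_extChartAt_source (I := 𝓡 n) x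
  have := coord_mlieBracket hx ((contDiffAt_rep_ext hx u).differentiableAt (by norm_num))
    ((contDiffAt_rep_ext hx v).differentiableAt (by norm_num))
  rw [(rep_ext_eventuallyEq u).fderiv_eq, (rep_ext_eventuallyEq v).fderiv_eq] at this
  rw [← coordSymm_coord hx (VectorField.mlieBracket (𝓡 n) (ext u) (ext v) x), this]
  simp

theorem coord_torsion (hy : y ∈ (extChartAt (𝓡 n) x).source) (u v : TangentSpace (𝓡 n) y) :
    coord x y (nabla.torsion y u v) =
      chr nabla x (extChartAt (𝓡 n) x y) (coord x y u) (coord x y v)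
        - chr nabla x (extChartAt (𝓡 n) x y) (coord x y v) (coord x y u) := by
  have hc := fun u => mdifferentiableAt_constField hy u
  have hd := fun u => (mdifferentiableAt_iff_rep hy).1 (hc u)
  have he := fun u => rep_constField_eventuallyEq hy u
  have h := nabla.torsion_apply (hc (coord x y u)) (hc (coord x y v))
  simp only [constField, coordSymm_coord hy] at h
  change _ = nabla (constField x (coord x y v)) y u - nabla (constField x (coord x y u)) y v
    - VectorField.mlieBracket (𝓡 n) (constField x (coord x y u)) (constField x (coord x y v)) y at h
  rw [h, map_sub, map_sub, coord_connection hy (hd _), coord_connection hy (hd _),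
    coord_mlieBracket hy (hd _) (hd _)]
  rw [(he (coord x y u)).fderiv_eq, (he (coord x y v)).fderiv_eq, (he (coord x y u)).self_of_nhds,
    (he (coord x y v)).self_of_nhds]
  simp

end Christoffel

/-! ### Smoothness of the Christoffel symbols -/

section Smoothness

variable {n : ℕ} {M : Type*} [TopologicalSpace M] [ChartedSpace (EuclideanSpace ℝ (Fin n)) M]
  [IsManifold (𝓡 n) ∞ M] {nabla : Connection n M} {x y : M}

theorem contMDiffAt_constField (hy : y ∈ (extChartAt (𝓡 n) x).source)
    (u : EuclideanSpace ℝ (Fin n)) :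
    ContMDiffAt (𝓡 n) ((𝓡 n).prod 𝓘(ℝ, EuclideanSpace ℝ (Fin n))) ∞
      (fun y => Bundle.TotalSpace.mk' (EuclideanSpace ℝ (Fin n)) y (constField x u y)) y := by
  rw [Bundle.Trivialization.contMDiffAt_section_iff
    (trivializationAt (EuclideanSpace ℝ (Fin n)) (fun x : M => TangentSpace (𝓡 n) x) x)
    (mem_baseSet_of_mem_source hy)]
  refine (contMDiffAt_const (c := u)).congr_of_eventuallyEq ?_
  filter_upwards [extChartAt_source_mem_nhds' (I := 𝓡 n) hy] with y' hy'
  rw [← Bundle.Trivialization.continuousLinearMapAt_apply_of_mem ℝ _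
      (mem_baseSet_of_mem_source hy')]
  exact coord_coordSymm hy' u

/-- Smoothness of the connection is applied to a globally smooth field, whereas a coordinate field
is smooth only on the chart domain. Multiplying by a bump function equal to `1` near `x` bridges the
gap, as the connection is local. -/
theorem contDiffAt_chrAux [T2Space M] (h : nabla.ContMDiffCovariantDerivative ∞) (k : Fin n) :
    ContDiffAt ℝ ∞ (fun z => chrAux nabla x z k) (extChartAt (𝓡 n) x x) := by
  have hx := mem_extChartAt_source (I := 𝓡 n) x
  let ψ : SmoothBumpFunction (𝓡 n) x := Classical.arbitrary _
  let C := constField x (EuclideanSpace.single k (1 : ℝ))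
  have hsm : ContMDiff (𝓡 n) ((𝓡 n).prod 𝓘(ℝ, EuclideanSpace ℝ (Fin n))) ∞
      (fun y => Bundle.TotalSpace.mk' (EuclideanSpace ℝ (Fin n)) y (((ψ : M → ℝ) • C) y)) := by
    refine ContMDiffOn.smul_section_of_tsupport (u := (extChartAt (𝓡 n) x).source)
      ψ.contMDiff.contMDiffOn (isOpen_extChartAt_source x) ?_
      fun y hy => (contMDiffAt_constField hy _).contMDiffWithinAt
    simpa only [extChartAt_source] using ψ.tsupport_subset_chartAt_source
  have hn := (h.contMDiff.contMDiff hsm.contMDiffOn).contMDiffAt (x := x) Filter.univ_mem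
  rw [contMDiffAt_hom_bundle] at hn
  have h2 := hn.2
  have h3 : ContMDiffAt (𝓡 n)
      𝓘(ℝ, EuclideanSpace ℝ (Fin n) →L[ℝ] EuclideanSpace ℝ (Fin n)) ∞
      (fun y => coord x y ∘L nabla C y ∘L coordSymm x y) x := by
    refine h2.congr_of_eventuallyEq ?_
    filter_upwards [ψ.eventuallyEq_one.eventually_nhds,
      extChartAt_source_mem_nhds' (I := 𝓡 n) hx] with y hy hys
    have : nabla ((ψ : M → ℝ) • C) y = nabla C y := by
      refine nabla.isCovariantDerivativeOnUniv.congr_of_eventuallyEq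
        (hsm.contMDiffAt.mdifferentiableAt (by simp)) (mdifferentiableAt_constField hys _)
        Filter.univ_mem ?_
      filter_upwards [hy] with y' hy'
      rw [Pi.smul_apply', hy']
      simp
    rw [← this]
    rfl
  rw [← contMDiffAt_iff_contDiffAt]
  exact h3.comp_of_eq (contMDiffAt_symm hx) ((extChartAt (𝓡 n) x).left_inv hx)

theorem contDiffAt_chr [T2Space M] (h : nabla.ContMDiffCovariantDerivative ∞) :
    ContDiffAt ℝ ∞ (chr nabla x) (extChartAt (𝓡 n) x x) := by
  have : ContDiffAt ℝ ∞ (fun z => ∑ k, (EuclideanSpace.proj k :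
      EuclideanSpace ℝ (Fin n) →L[ℝ] ℝ).smulRight (chrAux nabla x z k)) (extChartAt (𝓡 n) x x) :=
    ContDiffAt.sum fun k _ => ContDiffAt.comp (g := ContinuousLinearMap.smulRightL ℝ _ _
      (EuclideanSpace.proj k : EuclideanSpace ℝ (Fin n) →L[ℝ] ℝ)) (extChartAt (𝓡 n) x x)
      (ContinuousLinearMap.contDiff _).contDiffAt (contDiffAt_chrAux h k)
  exact (ContinuousLinearMap.flipₗᵢ ℝ _ _ _).contDiff.contDiffAt.comp (extChartAt (𝓡 n) x x) this

end Smoothness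

/-! ### The metric and the orthonormal frames in a chart -/

section Metric

variable {n : ℕ} {M : Type*} [TopologicalSpace M] [ChartedSpace (EuclideanSpace ℝ (Fin n)) M]
  [IsManifold (𝓡 n) ∞ M]
  [Bundle.RiemannianBundle (fun x : M => TangentSpace (𝓡 n) x)]

/-- The metric in the chart at `x`. -/
noncomputable def chartMetric (x : M) (z : EuclideanSpace ℝ (Fin n)) :
    EuclideanSpace ℝ (Fin n) →L[ℝ] EuclideanSpace ℝ (Fin n) →L[ℝ] ℝ :=
  ∑ i, ∑ j, (inner ℝ (constField x (EuclideanSpace.single i 1) ((extChartAt (𝓡 n) x).symm z))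
    (constField x (EuclideanSpace.single j 1) ((extChartAt (𝓡 n) x).symm z)) : ℝ) •
    (EuclideanSpace.proj i : EuclideanSpace ℝ (Fin n) →L[ℝ] ℝ).smulRight
      (EuclideanSpace.proj j : EuclideanSpace ℝ (Fin n) →L[ℝ] ℝ)

variable {x y : M}

theorem chartMetric_apply (z u v : EuclideanSpace ℝ (Fin n)) :
    chartMetric x z u v = inner ℝ (constField x u ((extChartAt (𝓡 n) x).symm z))
      (constField x v ((extChartAt (𝓡 n) x).symm z)) := by
  have h : ∀ w : EuclideanSpace ℝ (Fin n), constField x w ((extChartAt (𝓡 n) x).symm z) =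
      ∑ k, w k • constField x (EuclideanSpace.single k 1) ((extChartAt (𝓡 n) x).symm z) := by
    intro w
    simp only [constField, ← map_smul, ← map_sum]
    rw [sum_smul_single]
  rw [h u, h v, sum_inner]
  simp only [inner_sum, inner_smul_left, inner_smul_right, chartMetric, sum_apply, smul_apply,
    ContinuousLinearMap.smulRight_apply]
  refine Finset.sum_congr rfl fun i _ => Finset.sum_congr rfl fun j _ => ?_
  change _ * (u i * v j) = _
  simp only [conj_trivial]
  ring

theorem chartMetric_coord (hy : y ∈ (extChartAt (𝓡 n) x).source) (u v : TangentSpace (𝓡 n) y) :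
    chartMetric x (extChartAt (𝓡 n) x y) (coord x y u) (coord x y v) = inner ℝ u v := by
  rw [chartMetric_apply, (extChartAt (𝓡 n) x).left_inv hy, constField, constField,
    coordSymm_coord hy, coordSymm_coord hy]

/-- The orthonormal frames, in the chart at `x`. -/
noncomputable def chartFrame (x : M) (z : EuclideanSpace ℝ (Fin n)) (a : Fin n) :
    EuclideanSpace ℝ (Fin n) :=
  coord x ((extChartAt (𝓡 n) x).symm z) (frame ((extChartAt (𝓡 n) x).symm z) a)

theorem chartFrame_apply (hy : y ∈ (extChartAt (𝓡 n) x).source) (a : Fin n) :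
    chartFrame x (extChartAt (𝓡 n) x y) a = coord x y (frame y a) := by
  rw [chartFrame, (extChartAt (𝓡 n) x).left_inv hy]

theorem isOrthonormalFor_chartFrame (hy : y ∈ (extChartAt (𝓡 n) x).source) :
    IsOrthonormalFor (chartMetric x (extChartAt (𝓡 n) x y))
      (chartFrame x (extChartAt (𝓡 n) x y)) := by
  intro a b
  rw [chartFrame_apply hy, chartFrame_apply hy, chartMetric_coord hy]
  exact orthonormal_iff_ite.1 (frame y).orthonormal a b

variable [IsContMDiffRiemannianBundle (𝓡 n) ∞ (EuclideanSpace ℝ (Fin n))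
    (fun x : M => TangentSpace (𝓡 n) x)]

theorem contDiffAt_chartMetric : ContDiffAt ℝ ∞ (chartMetric x) (extChartAt (𝓡 n) x x) := by
  have hx := mem_extChartAt_source (I := 𝓡 n) x
  refine ContDiffAt.sum fun i _ => ContDiffAt.sum fun j _ => ContDiffAt.fun_smul ?_ contDiffAt_const
  have h := ContMDiffAt.inner_bundle (contMDiffAt_constField hx (EuclideanSpace.single i (1 : ℝ)))
    (contMDiffAt_constField hx (EuclideanSpace.single j (1 : ℝ)))
  rw [← contMDiffAt_iff_contDiffAt]
  exact h.comp_of_eq (contMDiffAt_symm hx) ((extChartAt (𝓡 n) x).left_inv hx)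

theorem fderiv_chartMetric {nabla : Connection n M} (h : nabla.IsMetricCompatible)
    (hy : y ∈ (extChartAt (𝓡 n) x).source)
    (hg : DifferentiableAt ℝ (chartMetric x) (extChartAt (𝓡 n) x y))
    (w u v : EuclideanSpace ℝ (Fin n)) :
    fderiv ℝ (chartMetric x) (extChartAt (𝓡 n) x y) w u v =
      chartMetric x (extChartAt (𝓡 n) x y) (chr nabla x (extChartAt (𝓡 n) x y) w u) v
      + chartMetric x (extChartAt (𝓡 n) x y) u (chr nabla x (extChartAt (𝓡 n) x y) w v) := by
  have hc := fun u => mdifferentiableAt_constField hy u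
  have he := fun u => rep_constField_eventuallyEq hy u
  have hn : ∀ u, coord x y (nabla (constField x u) y (coordSymm x y w)) =
      chr nabla x (extChartAt (𝓡 n) x y) w u := by
    intro u
    rw [coord_connection hy ((mdifferentiableAt_iff_rep hy).1 (hc u)), coord_coordSymm hy,
      (he u).fderiv_eq, (he u).self_of_nhds]
    simp
  have key := h.mvfderiv_inner_eq (constField x w) (hc u) (hc v)
  have hfun : (fun z => inner ℝ (constField x u ((extChartAt (𝓡 n) x).symm z))
      (constField x v ((extChartAt (𝓡 n) x).symm z))) = fun z => chartMetric x z u v := by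
    funext z
    rw [chartMetric_apply]
  rw [mvfderiv_eq_of_comp_symm hy (by
    rw [hfun]
    exact differentiableAt_clm_apply₂ hg (differentiableAt_const u) (differentiableAt_const v)),
    hfun, fderiv_clm_apply_const₂ hg, constField, coord_coordSymm hy] at key
  rw [key]
  beta_reduce
  rw [← chartMetric_coord hy, ← chartMetric_coord hy]
  simp only [constField, coord_coordSymm hy]
  rw [← hn, ← hn]

end Metric

/-! ### The local model of the manifold and the Levi-Civita symbols -/

section Model

variable {n : ℕ} {M : Type*} [TopologicalSpace M] [ChartedSpace (EuclideanSpace ℝ (Fin n)) M]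
  [IsManifold (𝓡 n) ∞ M]

/-- The symmetric part of the Christoffel symbol. -/
noncomputable def chrSymm (nabla : Connection n M) (x : M) (z : EuclideanSpace ℝ (Fin n)) :
    EuclideanSpace ℝ (Fin n) →L[ℝ] EuclideanSpace ℝ (Fin n) →L[ℝ] EuclideanSpace ℝ (Fin n) :=
  (1 / 2 : ℝ) • (chr nabla x z + (chr nabla x z).flip)

/-- The torsion in the chart at `x`. -/
noncomputable def chrTorsion (nabla : Connection n M) (x : M) (z : EuclideanSpace ℝ (Fin n)) :
    EuclideanSpace ℝ (Fin n) →L[ℝ] EuclideanSpace ℝ (Fin n) →L[ℝ] EuclideanSpace ℝ (Fin n) :=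
  chr nabla x z - (chr nabla x z).flip

variable {nabla nablaG : Connection n M} {x y : M}

theorem chr_eq (nabla : Connection n M) (x : M) :
    chr nabla x = fun z => chrSymm nabla x z + (1 / 2 : ℝ) • chrTorsion nabla x z := by
  funext z
  rw [chrSymm, chrTorsion]
  module

variable [Bundle.RiemannianBundle (fun x : M => TangentSpace (𝓡 n) x)]

theorem torsionForm_eq_chart (hy : y ∈ (extChartAt (𝓡 n) x).source) (u v w : TangentSpace (𝓡 n) y) :
    torsionForm nabla y u v w = chartT (chartMetric x) (chrTorsion nabla x) (extChartAt (𝓡 n) x y)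
      (coord x y u) (coord x y v) (coord x y w) := by
  rw [torsionForm, ← chartMetric_coord hy, coord_torsion hy]
  rfl

theorem chartMetric_nondegenerate (hy : y ∈ (extChartAt (𝓡 n) x).source)
    (u : EuclideanSpace ℝ (Fin n))
    (h : ∀ v, chartMetric x (extChartAt (𝓡 n) x y) u v = 0) : u = 0 := by
  have h1 := h u
  rw [← coord_coordSymm hy u, chartMetric_coord hy, inner_self_eq_zero] at h1
  rw [← coord_coordSymm hy u, h1, map_zero]

theorem chartMetric_symm (z u v : EuclideanSpace ℝ (Fin n)) :
    chartMetric x z u v = chartMetric x z v u := by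
  rw [chartMetric_apply, chartMetric_apply, real_inner_comm]

variable [IsContMDiffRiemannianBundle (𝓡 n) ∞ (EuclideanSpace ℝ (Fin n))
    (fun x : M => TangentSpace (𝓡 n) x)]

/-- The symmetric part of the Christoffel symbols is itself metric: the torsion part would add
`g(τ(w,u),v) + g(u,τ(w,v))`, up to the factor `1/2`, to the derivative of `g`, and this vanishes by
total skewness. -/
theorem chartModel [T2Space M] (h : IsMetricWithSkewTorsion nabla) (x : M) :
    ChartModel (chartMetric x) (chrSymm nabla x) (chrTorsion nabla x) (chartFrame x)
      (extChartAt (𝓡 n) x x) := by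
  have hx := mem_extChartAt_source (I := 𝓡 n) x
  have hg : ContDiffAt ℝ 2 (chartMetric x) (extChartAt (𝓡 n) x x) :=
    contDiffAt_chartMetric.of_le (WithTop.coe_le_coe.2 le_top)
  have hΓ : ContDiffAt ℝ 2 (chr nabla x) (extChartAt (𝓡 n) x x) :=
    (contDiffAt_chr h.smooth).of_le (WithTop.coe_le_coe.2 le_top)
  have hΓf : ContDiffAt ℝ 2 (fun z => (chr nabla x z).flip) (extChartAt (𝓡 n) x x) :=
    (ContinuousLinearMap.flipₗᵢ ℝ (EuclideanSpace ℝ (Fin n)) (EuclideanSpace ℝ (Fin n))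
      (EuclideanSpace ℝ (Fin n))).contDiff.contDiffAt.comp (extChartAt (𝓡 n) x x) hΓ
  have hskew : ∀ᶠ z in nhds (extChartAt (𝓡 n) x x), ∀ u v w,
      chartMetric x z (chrTorsion nabla x z u v) w =
        -chartMetric x z (chrTorsion nabla x z u w) v := by
    filter_upwards [eventually_mem_target hx] with z hz u v w
    have hy := symm_mem_source hz
    have := h.skew₂₃ _ (coordSymm x ((extChartAt (𝓡 n) x).symm z) u)
      (coordSymm x ((extChartAt (𝓡 n) x).symm z) v) (coordSymm x ((extChartAt (𝓡 n) x).symm z) w)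
    rw [torsionForm_eq_chart hy, torsionForm_eq_chart hy] at this
    simpa only [coord_coordSymm hy, (extChartAt (𝓡 n) x).right_inv hz, chartT] using this
  refine ⟨by simp, hg, (hΓ.add hΓf).const_smul _, hΓ.sub hΓf,
    .of_forall fun z => chartMetric_symm z,
    .of_forall fun z u v => ?_, ?_, .of_forall fun z u v => ?_, hskew, ?_⟩
  · simp [chrSymm, add_comm]
  · filter_upwards [eventually_mem_target hx, hg.eventually (by norm_num), hskew]
      with z hz hgz hs w u v
    have hy := symm_mem_source hz
    have hr := (extChartAt (𝓡 n) x).right_inv hz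
    have := fderiv_chartMetric h.metric hy
      (by rw [hr]; exact hgz.differentiableAt (by norm_num)) w u v
    rw [hr, chr_eq] at this
    rw [this]
    have h1 := hs w u v
    rw [chartMetric_symm z (chrTorsion nabla x z w v) u] at h1
    simp only [add_apply, smul_apply, map_add, map_smul, smul_eq_mul]
    linarith
  · simp [chrTorsion]
  · filter_upwards [eventually_mem_target hx] with z hz
    have := isOrthonormalFor_chartFrame (symm_mem_source hz)
    rwa [(extChartAt (𝓡 n) x).right_inv hz] at this

/-- Uniqueness of the Levi-Civita connection: the difference of the two symbols, lowered by the
metric, is symmetric in the first two and skew in the last two arguments, hence zero. Regularity of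
`nablaG`, which `IsLeviCivita` does not include, comes out of this equality. -/
theorem chr_leviCivita [T2Space M] (h : IsMetricWithSkewTorsion nabla) (hG : IsLeviCivita nablaG)
    (x : M) : chr nablaG x =ᶠ[nhds (extChartAt (𝓡 n) x x)] chrSymm nabla x := by
  have hx := mem_extChartAt_source (I := 𝓡 n) x
  have hm := chartModel h x
  filter_upwards [eventually_mem_target hx, hm.contDiff_g.eventually (by norm_num), hm.metric,
    hm.symm_S] with z hz hgz hmet hsym
  have hy := symm_mem_source hz
  have hr := (extChartAt (𝓡 n) x).right_inv hz
  have hsymG : ∀ u v, chr nablaG x z u v = chr nablaG x z v u := by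
    intro u v
    have := coord_torsion (nabla := nablaG) hy (coordSymm x ((extChartAt (𝓡 n) x).symm z) u)
      (coordSymm x ((extChartAt (𝓡 n) x).symm z) v)
    have h0 : nablaG.torsion _ (coordSymm x ((extChartAt (𝓡 n) x).symm z) u)
        (coordSymm x ((extChartAt (𝓡 n) x).symm z) v) = 0 := by
      rw [hG.torsion_eq_zero]
      rfl
    rw [h0, map_zero] at this
    simp only [coord_coordSymm hy, hr] at this
    exact sub_eq_zero.1 this.symm
  have hmetG : ∀ w u v, fderiv ℝ (chartMetric x) z w u v =
      chartMetric x z (chr nablaG x z w u) v + chartMetric x z u (chr nablaG x z w v) := by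
    have := fderiv_chartMetric hG.metric hy (by rw [hr]; exact hgz.differentiableAt (by norm_num))
    rwa [hr] at this
  ext1 u
  ext1 v
  refine sub_eq_zero.1 (chartMetric_nondegenerate hy _ fun w => ?_)
  rw [hr]
  let D : EuclideanSpace ℝ (Fin n) → EuclideanSpace ℝ (Fin n) → EuclideanSpace ℝ (Fin n) → ℝ :=
    fun u v w => chartMetric x z (chr nablaG x z u v - chrSymm nabla x z u v) w
  have d1 : ∀ u v w, D u v w = D v u w := by
    intro u v w
    simp only [D, hsymG u v, hsym u v]
  have d2 : ∀ u v w, D u v w = -D u w v := by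
    intro u v w
    have e1 := hmet u v w
    rw [hmetG u v w, chartMetric_symm z v, chartMetric_symm z v] at e1
    simp only [D, map_sub, sub_apply]
    linarith
  change D u v w = 0
  linarith [d1 u v w, d2 v u w, d1 v w u, d2 w v u, d1 w u v, d2 u w v]

end Model

/-! ### Covariant and exterior derivatives of tensor fields in a chart -/

section Identification

variable {n : ℕ} {M : Type*} [TopologicalSpace M] [ChartedSpace (EuclideanSpace ℝ (Fin n)) M]
  [IsManifold (𝓡 n) ∞ M]
  {nabla : Connection n M} {x y : M}

/-- The coordinate expression of a covariant 2-tensor field. -/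
def IsChart₂ (x : M) (B : Π y : M, TangentSpace (𝓡 n) y → TangentSpace (𝓡 n) y → ℝ)
    (A : EuclideanSpace ℝ (Fin n) → EuclideanSpace ℝ (Fin n) → EuclideanSpace ℝ (Fin n) → ℝ) :
    Prop :=
  ∀ y ∈ (extChartAt (𝓡 n) x).source, ∀ u v : TangentSpace (𝓡 n) y,
    B y u v = A (extChartAt (𝓡 n) x y) (coord x y u) (coord x y v)

/-- The coordinate expression of a covariant 3-tensor field. -/
def IsChart₃ (x : M)
    (B : Π y : M, TangentSpace (𝓡 n) y → TangentSpace (𝓡 n) y → TangentSpace (𝓡 n) y → ℝ)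
    (A : EuclideanSpace ℝ (Fin n) → EuclideanSpace ℝ (Fin n) → EuclideanSpace ℝ (Fin n) →
      EuclideanSpace ℝ (Fin n) → ℝ) : Prop :=
  ∀ y ∈ (extChartAt (𝓡 n) x).source, ∀ u v w : TangentSpace (𝓡 n) y,
    B y u v w = A (extChartAt (𝓡 n) x y) (coord x y u) (coord x y v) (coord x y w)

theorem mvfderiv_eq_of_eventuallyEq {f : M → ℝ} {F : EuclideanSpace ℝ (Fin n) → ℝ}
    (h : (fun z => f ((extChartAt (𝓡 n) x).symm z)) =ᶠ[nhds (extChartAt (𝓡 n) x x)] F)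
    (hF : DifferentiableAt ℝ F (extChartAt (𝓡 n) x x)) (v : TangentSpace (𝓡 n) x) :
    mvfderiv (𝓡 n) f x v = fderiv ℝ F (extChartAt (𝓡 n) x x) (coord x x v) := by
  rw [mvfderiv_eq_of_comp_symm (mem_extChartAt_source (I := 𝓡 n) x)
    (hF.congr_of_eventuallyEq h), h.fderiv_eq]

theorem coord_ext {z : EuclideanSpace ℝ (Fin n)} (hz : z ∈ (extChartAt (𝓡 n) x).target)
    (u : TangentSpace (𝓡 n) x) : coord x ((extChartAt (𝓡 n) x).symm z)
      (ext u ((extChartAt (𝓡 n) x).symm z)) = coord x x u := by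
  rw [ext_eq_constField _ (symm_mem_source hz), constField, coord_coordSymm (symm_mem_source hz)]

theorem IsChart₂.covDeriv_eq {B : Π y : M, TangentSpace (𝓡 n) y → TangentSpace (𝓡 n) y → ℝ}
    {A : EuclideanSpace ℝ (Fin n) → EuclideanSpace ℝ (Fin n) → EuclideanSpace ℝ (Fin n) → ℝ}
    (h : IsChart₂ x B A)
    (hA : ∀ u v, DifferentiableAt ℝ (fun z => A z u v) (extChartAt (𝓡 n) x x))
    (w u v : TangentSpace (𝓡 n) x) :
    covDeriv₂ nabla B x w u v = chartCov₂ (chr nabla x (extChartAt (𝓡 n) x x)) A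
      (extChartAt (𝓡 n) x x) (coord x x w) (coord x x u) (coord x x v) := by
  have hx := mem_extChartAt_source (I := 𝓡 n) x
  rw [covDeriv₂, h x hx, h x hx, coord_connection_ext, coord_connection_ext, chartCov₂,
    mvfderiv_eq_of_eventuallyEq ?_ (hA (coord x x u) (coord x x v))]
  filter_upwards [eventually_mem_target hx] with z hz
  rw [h _ (symm_mem_source hz), coord_ext hz, coord_ext hz, (extChartAt (𝓡 n) x).right_inv hz]

variable {B : Π y : M, TangentSpace (𝓡 n) y → TangentSpace (𝓡 n) y → TangentSpace (𝓡 n) y → ℝ}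
    {A : EuclideanSpace ℝ (Fin n) → EuclideanSpace ℝ (Fin n) → EuclideanSpace ℝ (Fin n) →
      EuclideanSpace ℝ (Fin n) → ℝ}

theorem IsChart₃.mvfderiv_eq (h : IsChart₃ x B A)
    (hA : ∀ u v w, DifferentiableAt ℝ (fun z => A z u v w) (extChartAt (𝓡 n) x x))
    (t u v w : TangentSpace (𝓡 n) x) :
    mvfderiv (𝓡 n) (fun y => B y (ext u y) (ext v y) (ext w y)) x t =
      fderiv ℝ (fun z => A z (coord x x u) (coord x x v) (coord x x w)) (extChartAt (𝓡 n) x x)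
        (coord x x t) := by
  refine mvfderiv_eq_of_eventuallyEq ?_ (hA _ _ _) _
  filter_upwards [eventually_mem_target (mem_extChartAt_source (I := 𝓡 n) x)] with z hz
  rw [h _ (symm_mem_source hz), coord_ext hz, coord_ext hz, coord_ext hz,
    (extChartAt (𝓡 n) x).right_inv hz]

theorem IsChart₃.covDeriv_eq (h : IsChart₃ x B A)
    (hA : ∀ u v w, DifferentiableAt ℝ (fun z => A z u v w) (extChartAt (𝓡 n) x x))
    (t u v w : TangentSpace (𝓡 n) x) :
    covDeriv₃ nabla B x t u v w = chartCov₃ (chr nabla x (extChartAt (𝓡 n) x x)) A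
      (extChartAt (𝓡 n) x x) (coord x x t) (coord x x u) (coord x x v) (coord x x w) := by
  have hx := mem_extChartAt_source (I := 𝓡 n) x
  rw [covDeriv₃, h.mvfderiv_eq hA, h x hx, h x hx, h x hx, coord_connection_ext,
    coord_connection_ext, coord_connection_ext, chartCov₃]

/-- The extensions have constant coefficients in the chart at `x`, so all bracket terms vanish;
`hA0` replaces linearity of `A` there. -/
theorem IsChart₃.extDeriv_eq (h : IsChart₃ x B A)
    (hA : ∀ u v w, DifferentiableAt ℝ (fun z => A z u v w) (extChartAt (𝓡 n) x x))
    (hA0 : ∀ u v, A (extChartAt (𝓡 n) x x) 0 u v = 0)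
    (u₀ u₁ u₂ u₃ : TangentSpace (𝓡 n) x) :
    extDeriv₃ B x u₀ u₁ u₂ u₃ =
      fderiv ℝ (fun z => A z (coord x x u₁) (coord x x u₂) (coord x x u₃)) (extChartAt (𝓡 n) x x)
        (coord x x u₀)
      - fderiv ℝ (fun z => A z (coord x x u₀) (coord x x u₂) (coord x x u₃)) (extChartAt (𝓡 n) x x)
        (coord x x u₁)
      + fderiv ℝ (fun z => A z (coord x x u₀) (coord x x u₁) (coord x x u₃)) (extChartAt (𝓡 n) x x)
        (coord x x u₂)
      - fderiv ℝ (fun z => A z (coord x x u₀) (coord x x u₁) (coord x x u₂)) (extChartAt (𝓡 n) x x)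
        (coord x x u₃) := by
  have hx := mem_extChartAt_source (I := 𝓡 n) x
  have h0 : ∀ u v, B x 0 u v = 0 := by
    intro u v
    rw [h x hx, map_zero, hA0]
  simp only [extDeriv₃, mlieBracket_ext, h0, h.mvfderiv_eq hA]
  ring

end Identification

/-! ### Functions with vanishing differential -/

section Constancy

variable {n : ℕ} {M : Type*} [TopologicalSpace M] [ChartedSpace (EuclideanSpace ℝ (Fin n)) M]
  [IsManifold (𝓡 n) ∞ M]

theorem isLocallyConstant_of_hasMFDerivAt_zero {f : M → ℝ}
    (hf : ∀ x, HasMFDerivAt (𝓡 n) 𝓘(ℝ, ℝ) f x 0) : IsLocallyConstant f := by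
  refine (IsLocallyConstant.iff_eventually_eq f).2 fun x => ?_
  have hx := mem_extChartAt_source (I := 𝓡 n) x
  obtain ⟨r, hr, hball⟩ := Metric.mem_nhds_iff.1 (eventually_mem_target hx)
  have hd : ∀ z ∈ Metric.ball (extChartAt (𝓡 n) x x) r,
      HasFDerivAt (fun z => f ((extChartAt (𝓡 n) x).symm z))
        (0 : EuclideanSpace ℝ (Fin n) →L[ℝ] ℝ) z := by
    intro z hz
    have hy := symm_mem_source (hball hz)
    have h1 := (contMDiffAt_symm hy).mdifferentiableAt (by simp)
    rw [(extChartAt (𝓡 n) x).right_inv (hball hz)] at h1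
    have h2 := (hf ((extChartAt (𝓡 n) x).symm z)).comp z h1.hasMFDerivAt
    rw [ContinuousLinearMap.zero_comp] at h2
    exact hasMFDerivAt_iff_hasFDerivAt.1 h2
  have hball' : extChartAt (𝓡 n) x ⁻¹' Metric.ball (extChartAt (𝓡 n) x x) r ∈ nhds x :=
    (continuousAt_extChartAt x).preimage_mem_nhds (Metric.ball_mem_nhds _ hr)
  filter_upwards [hball', extChartAt_source_mem_nhds (I := 𝓡 n) x] with y hy hys
  have := Metric.isOpen_ball.is_const_of_fderiv_eq_zero
    (convex_ball (extChartAt (𝓡 n) x x) r).isPreconnected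
    (fun z hz => (hd z hz).differentiableAt.differentiableWithinAt)
    (fun z hz => (hd z hz).fderiv) hy (Metric.mem_ball_self hr)
  rwa [(extChartAt (𝓡 n) x).left_inv hys, (extChartAt (𝓡 n) x).left_inv hx] at this

theorem exists_eq_const_of_hasMFDerivAt_zero [PreconnectedSpace M] {f : M → ℝ}
    (hf : ∀ x, HasMFDerivAt (𝓡 n) 𝓘(ℝ, ℝ) f x 0) : ∃ C, ∀ x, f x = C := by
  rcases isEmpty_or_nonempty M with h | ⟨⟨x⟩⟩
  · exact ⟨0, fun x => h.elim x⟩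
  · exact ⟨f x, fun y =>
      (isLocallyConstant_of_hasMFDerivAt_zero hf).apply_eq_of_preconnectedSpace y x⟩

end Constancy

theorem chartRm_congr {E : Type*} [NormedAddCommGroup E] [NormedSpace ℝ E]
    {Γ Γ' : E → E →L[ℝ] E →L[ℝ] E} {z : E} (h : Γ =ᶠ[nhds z] Γ') (u v w : E) :
    chartRm Γ z u v w = chartRm Γ' z u v w := by
  rw [chartRm, chartRm, h.fderiv_eq, h.self_of_nhds]

/-- The exterior derivative of the torsion is the alternation of its covariant derivative. -/
theorem ChartModel.extDeriv_eq_cov {n : ℕ} {E : Type*} [NormedAddCommGroup E] [NormedSpace ℝ E]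
    {g : E → E →L[ℝ] E →L[ℝ] ℝ} {S τ : E → E →L[ℝ] E →L[ℝ] E} {c : E → Fin n → E} {p : E}
    (h : ChartModel g S τ c p) (w a b d : E) :
    fderiv ℝ (fun z => chartT g τ z a b d) p w - fderiv ℝ (fun z => chartT g τ z w b d) p a
      + fderiv ℝ (fun z => chartT g τ z w a d) p b - fderiv ℝ (fun z => chartT g τ z w a b) p d =
    chartCov₃ (S p) (chartT g τ) p w a b d - chartCov₃ (S p) (chartT g τ) p a w b d
      + chartCov₃ (S p) (chartT g τ) p b w a d - chartCov₃ (S p) (chartT g τ) p d w a b := by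
  have s := h.symm_S.self_of_nhds
  have t12 := h.T_swap₁₂
  have t23 := h.T_swap₂₃
  simp only [chartCov₃]
  -- With the arguments of `S` in a fixed order, the Christoffel terms meet in pairs that cancel by
  -- skewness of `T`.
  rw [s a w, s b w, s d w, s b a, s d a, s d b]
  linarith [t12 a (S p w b) d, t23 a b (S p w d), t12 a (S p w d) b,
    t12 w (S p a b) d, t23 w b (S p a d), t12 w (S p a d) b, t12 w (S p b d) a,
    t23 w a (S p b d), t12 (S p w a) b d, t12 (S p w b) a d, t12 (S p w d) a b, t23 w (S p a d) b,
    t23 w (S p b d) a]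

/-! ### Transfer of the local identities to the manifold -/

section Identification

variable {n : ℕ} {M : Type*} [TopologicalSpace M] [ChartedSpace (EuclideanSpace ℝ (Fin n)) M]
  [IsManifold (𝓡 n) ∞ M] [Bundle.RiemannianBundle (fun x : M => TangentSpace (𝓡 n) x)]
  {nabla nablaG : Connection n M} {x y : M}

theorem isChart_torsionForm : IsChart₃ x (torsionForm nabla)
    (chartT (chartMetric x) (chrTorsion nabla x)) :=
  fun _ hy => torsionForm_eq_chart hy

theorem isChart_tensorSq : IsChart₂ x (tensorSq (torsionForm nabla))
    (chartSq (chartT (chartMetric x) (chrTorsion nabla x)) (chartFrame x)) := by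
  intro y hy u v
  simp only [tensorSq, chartSq, torsionForm_eq_chart hy, chartFrame_apply hy]

theorem normSq_torsionForm_eq_chart (hy : y ∈ (extChartAt (𝓡 n) x).source) :
    normSq (torsionForm nabla) y = chartNorm (chartT (chartMetric x) (chrTorsion nabla x))
      (chartFrame x) (extChartAt (𝓡 n) x y) := by
  simp only [normSq, chartNorm, chartSq, torsionForm_eq_chart hy, chartFrame_apply hy, sq]

theorem curvature₄_eq_chart (hy : y ∈ (extChartAt (𝓡 n) x).source)
    (hΓ : DifferentiableAt ℝ (chr nabla x) (extChartAt (𝓡 n) x y))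
    (u v w t : TangentSpace (𝓡 n) y) :
    curvature₄ nabla y u v w t = chartMetric x (extChartAt (𝓡 n) x y)
      (chartRm (chr nabla x) (extChartAt (𝓡 n) x y) (coord x y u) (coord x y v) (coord x y w))
      (coord x y t) := by
  rw [curvature₄, ← chartMetric_coord hy, coord_curvature hy hΓ]

theorem ricci_eq_chart (hy : y ∈ (extChartAt (𝓡 n) x).source)
    (hΓ : DifferentiableAt ℝ (chr nabla x) (extChartAt (𝓡 n) x y)) (u v : TangentSpace (𝓡 n) y) :
    ricci nabla y u v = chartRic (chartMetric x) (chr nabla x) (chartFrame x)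
      (extChartAt (𝓡 n) x y) (coord x y u) (coord x y v) := by
  simp only [ricci, chartRic, curvature₄_eq_chart hy hΓ, chartFrame_apply hy]

theorem scal_eq_chart (hy : y ∈ (extChartAt (𝓡 n) x).source)
    (hΓ : DifferentiableAt ℝ (chr nabla x) (extChartAt (𝓡 n) x y)) :
    scal nabla y = chartScal (chartMetric x) (chr nabla x) (chartFrame x)
      (extChartAt (𝓡 n) x y) := by
  simp only [scal, chartScal, ricci_eq_chart hy hΓ, chartFrame_apply hy]

theorem normSq_eventuallyEq_chart (nabla : Connection n M) (x : M) :
    (fun z => normSq (torsionForm nabla) ((extChartAt (𝓡 n) x).symm z))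
      =ᶠ[nhds (extChartAt (𝓡 n) x x)]
      chartNorm (chartT (chartMetric x) (chrTorsion nabla x)) (chartFrame x) := by
  filter_upwards [eventually_mem_target (mem_extChartAt_source (I := 𝓡 n) x)] with z hzt
  rw [normSq_torsionForm_eq_chart (symm_mem_source hzt), (extChartAt (𝓡 n) x).right_inv hzt]

variable [T2Space M] [IsContMDiffRiemannianBundle (𝓡 n) ∞ (EuclideanSpace ℝ (Fin n))
    (fun x : M => TangentSpace (𝓡 n) x)]

theorem eventually_differentiableAt_chr (h : IsMetricWithSkewTorsion nabla) (x : M) :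
    ∀ᶠ z in nhds (extChartAt (𝓡 n) x x), DifferentiableAt ℝ (chr nabla x) z := by
  have hΓ : ContDiffAt ℝ 2 (chr nabla x) (extChartAt (𝓡 n) x x) :=
    (contDiffAt_chr h.smooth).of_le (WithTop.coe_le_coe.2 le_top)
  filter_upwards [hΓ.eventually (by norm_num)] with z hz using hz.differentiableAt (by norm_num)

theorem scal_eventuallyEq_chart (h : IsMetricWithSkewTorsion nabla) (x : M) :
    (fun z => scal nabla ((extChartAt (𝓡 n) x).symm z)) =ᶠ[nhds (extChartAt (𝓡 n) x x)]
      chartScal (chartMetric x) (chr nabla x) (chartFrame x) := by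
  filter_upwards [eventually_differentiableAt_chr h x,
    eventually_mem_target (mem_extChartAt_source (I := 𝓡 n) x)] with z hz hzt
  have hr := (extChartAt (𝓡 n) x).right_inv hzt
  rw [scal_eq_chart (symm_mem_source hzt) (by rwa [hr]), hr]

theorem differentiableAt_chartScal (h : IsMetricWithSkewTorsion nabla) (x : M) :
    DifferentiableAt ℝ (chartScal (chartMetric x) (chr nabla x) (chartFrame x))
      (extChartAt (𝓡 n) x x) := by
  rw [chr_eq]
  exact (chartModel h x).scal_torsion_differentiable.1

theorem mdifferentiableAt_scal (h : IsMetricWithSkewTorsion nabla) (x : M) :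
    MDifferentiableAt (𝓡 n) 𝓘(ℝ, ℝ) (scal nabla) x :=
  (hasMFDerivAt_of_comp_symm (mem_extChartAt_source (I := 𝓡 n) x)
    ((differentiableAt_chartScal h x).hasFDerivAt.congr_of_eventuallyEq
      (scal_eventuallyEq_chart h x))).mdifferentiableAt

theorem mdifferentiableAt_normSq_torsionForm (h : IsMetricWithSkewTorsion nabla) (x : M) :
    MDifferentiableAt (𝓡 n) 𝓘(ℝ, ℝ) (normSq (torsionForm nabla)) x :=
  (hasMFDerivAt_of_comp_symm (mem_extChartAt_source (I := 𝓡 n) x)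
    ((chartModel h x).norm_deriv.1.hasFDerivAt.congr_of_eventuallyEq
      (normSq_eventuallyEq_chart nabla x))).mdifferentiableAt

theorem mvfderiv_scal (h : IsMetricWithSkewTorsion nabla) (v : TangentSpace (𝓡 n) x) :
    mvfderiv (𝓡 n) (scal nabla) x v =
      fderiv ℝ (chartScal (chartMetric x) (chr nabla x) (chartFrame x)) (extChartAt (𝓡 n) x x)
        (coord x x v) :=
  mvfderiv_eq_of_eventuallyEq (scal_eventuallyEq_chart h x) (differentiableAt_chartScal h x) v

theorem mvfderiv_normSq_torsionForm (h : IsMetricWithSkewTorsion nabla)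
    (v : TangentSpace (𝓡 n) x) :
    mvfderiv (𝓡 n) (normSq (torsionForm nabla)) x v =
      fderiv ℝ (chartNorm (chartT (chartMetric x) (chrTorsion nabla x)) (chartFrame x))
        (extChartAt (𝓡 n) x x) (coord x x v) :=
  mvfderiv_eq_of_eventuallyEq (normSq_eventuallyEq_chart nabla x) (chartModel h x).norm_deriv.1 v

/-- The scalar curvatures of a metric connection with skew torsion and of the Levi-Civita
connection. -/
theorem scal_leviCivita (h : IsMetricWithSkewTorsion nabla) (hG : IsLeviCivita nablaG) (x : M) :
    scal nablaG x = scal nabla x + 1 / 4 * normSq (torsionForm nabla) x := by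
  have hx := mem_extChartAt_source (I := 𝓡 n) x
  have hm := chartModel h x
  have he := chr_leviCivita h hG x
  rw [scal_eq_chart hx (hm.differentiable_S.congr_of_eventuallyEq he),
    scal_eq_chart hx (eventually_differentiableAt_chr h x).self_of_nhds,
    normSq_torsionForm_eq_chart hx]
  have e2 := hm.scal_eq
  rw [← chr_eq] at e2
  rw [← e2]
  simp only [chartScal, chartRic, chartRm_congr he]

theorem divergence_tensorSq_eq_chart (h : IsMetricWithSkewTorsion nabla)
    (hG : IsLeviCivita nablaG) (v : TangentSpace (𝓡 n) x) :
    divergence₂ nablaG (tensorSq (torsionForm nabla)) x v =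
      ∑ s, chartCov₂ (chrSymm nabla x (extChartAt (𝓡 n) x x))
        (chartSq (chartT (chartMetric x) (chrTorsion nabla x)) (chartFrame x))
        (extChartAt (𝓡 n) x x) (chartFrame x (extChartAt (𝓡 n) x x) s)
        (chartFrame x (extChartAt (𝓡 n) x x) s) (coord x x v) := by
  have hx := mem_extChartAt_source (I := 𝓡 n) x
  simp only [divergence₂, chartFrame_apply hx, isChart_tensorSq.covDeriv_eq
    (fun u v => ((chartModel h x).sq_deriv u v).1), (chr_leviCivita h hG x).self_of_nhds]

theorem codiff_torsionForm_eq_chart (h : IsMetricWithSkewTorsion nabla)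
    (hG : IsLeviCivita nablaG) (u v : TangentSpace (𝓡 n) x) :
    codiff₃ nablaG (torsionForm nabla) x u v =
      -∑ s, chartCov₃ (chrSymm nabla x (extChartAt (𝓡 n) x x))
        (chartT (chartMetric x) (chrTorsion nabla x)) (extChartAt (𝓡 n) x x)
        (chartFrame x (extChartAt (𝓡 n) x x) s) (chartFrame x (extChartAt (𝓡 n) x x) s)
        (coord x x u) (coord x x v) := by
  have hx := mem_extChartAt_source (I := 𝓡 n) x
  simp only [codiff₃, chartFrame_apply hx, isChart_torsionForm.covDeriv_eq
    (chartModel h x).differentiable_T, (chr_leviCivita h hG x).self_of_nhds]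

/-- The divergence of `T²` in terms of the codifferential and of the exterior derivative. -/
theorem divergence_tensorSq (h : IsMetricWithSkewTorsion nabla) (hG : IsLeviCivita nablaG)
    (v : TangentSpace (𝓡 n) x) :
    divergence₂ nablaG (tensorSq (torsionForm nabla)) x v =
      -smallTheta nablaG (torsionForm nabla) x v
        + 1 / 6 * mvfderiv (𝓡 n) (normSq (torsionForm nabla)) x v
        - 1 / 3 * bigTheta (torsionForm nabla) x v := by
  have hx := mem_extChartAt_source (I := 𝓡 n) x
  have hm := chartModel h x
  have hA0 : ∀ u v,
      chartT (chartMetric x) (chrTorsion nabla x) (extChartAt (𝓡 n) x x) 0 u v = 0 := by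
    intro u v
    simp [chartT]
  rw [divergence_tensorSq_eq_chart h hG, hm.div_sq, mvfderiv_normSq_torsionForm h]
  simp only [smallTheta, bigTheta, codiff_torsionForm_eq_chart h hG, torsionForm_eq_chart hx,
    isChart_torsionForm.extDeriv_eq hm.differentiable_T hA0, hm.extDeriv_eq_cov,
    chartFrame_apply hx, neg_mul, Finset.sum_neg_distrib, neg_neg]

theorem divergence_tensorSq_of_pairSymmetric (h : IsMetricWithSkewTorsion nabla)
    (hG : IsLeviCivita nablaG) (hR : CurvaturePairSymmetric nabla) (v : TangentSpace (𝓡 n) x) :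
    divergence₂ nablaG (tensorSq (torsionForm nabla)) x v =
      -(1 / 2 * mvfderiv (𝓡 n) (normSq (torsionForm nabla)) x v) := by
  have hx := mem_extChartAt_source (I := 𝓡 n) x
  rw [divergence_tensorSq_eq_chart h hG, mvfderiv_normSq_torsionForm h]
  refine (chartModel h x).div_sq_of_pair_symm (fun u v w t => ?_) _
  have := hR x (coordSymm x x u) (coordSymm x x v) (coordSymm x x w) (coordSymm x x t)
  have hd := (eventually_differentiableAt_chr h x).self_of_nhds
  rw [curvature₄_eq_chart hx hd, curvature₄_eq_chart hx hd] at this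
  simpa only [coord_coordSymm hx, chr_eq nabla x] using this

theorem IsNablaEinstein.scal_identity (hE : IsNablaEinstein nabla)
    (h : IsMetricWithSkewTorsion nabla) (hG : IsLeviCivita nablaG) (hn : n ≠ 0)
    (v : TangentSpace (𝓡 n) x) :
    ((n : ℝ) - 2) / n * mvfderiv (𝓡 n) (scal nabla) x v
      - 1 / 2 * divergence₂ nablaG (tensorSq (torsionForm nabla)) x v
      + 1 / 4 * mvfderiv (𝓡 n) (normSq (torsionForm nabla)) x v = 0 := by
  rw [mvfderiv_scal h, mvfderiv_normSq_torsionForm h, divergence_tensorSq_eq_chart h hG, chr_eq]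
  refine (chartModel h x).einstein_identity hn ?_ _
  obtain ⟨lam, hlam⟩ := hE
  rw [← chr_eq]
  filter_upwards [eventually_differentiableAt_chr h x,
    eventually_mem_target (mem_extChartAt_source (I := 𝓡 n) x)] with z hz hzt
  have hr := (extChartAt (𝓡 n) x).right_inv hzt
  have hy := symm_mem_source hzt
  refine ⟨lam ((extChartAt (𝓡 n) x).symm z), fun u v => ?_⟩
  have := hlam _ (coordSymm x ((extChartAt (𝓡 n) x).symm z) u)
    (coordSymm x ((extChartAt (𝓡 n) x).symm z) v)
  rw [ricci_eq_chart hy (by rwa [hr]), ricci_eq_chart hy (by rwa [hr]),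
    ← chartMetric_coord hy] at this
  simpa only [coord_coordSymm hy, hr] using this

end Identification

/-! ### Integration of the relation between `d Scal` and `d‖T‖²` -/

section Conclusion

variable {n : ℕ} {M : Type*} [TopologicalSpace M] [ChartedSpace (EuclideanSpace ℝ (Fin n)) M]
  [IsManifold (𝓡 n) ∞ M] [Bundle.RiemannianBundle (fun x : M => TangentSpace (𝓡 n) x)]
  [T2Space M] [IsContMDiffRiemannianBundle (𝓡 n) ∞ (EuclideanSpace ℝ (Fin n))
    (fun x : M => TangentSpace (𝓡 n) x)] {nabla : Connection n M}

/-- The function `Scal + k ‖T‖²` has zero differential. -/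
theorem exists_scal_eq [PreconnectedSpace M] (h : IsMetricWithSkewTorsion nabla) {k : ℝ}
    (hk : ∀ (x : M) (v : TangentSpace (𝓡 n) x), mvfderiv (𝓡 n) (scal nabla) x v =
      -k * mvfderiv (𝓡 n) (normSq (torsionForm nabla)) x v) :
    ∃ C, ∀ x, scal nabla x = -k * normSq (torsionForm nabla) x + C := by
  obtain ⟨C, hC⟩ := exists_eq_const_of_hasMFDerivAt_zero (n := n)
    (f := scal nabla + k • normSq (torsionForm nabla)) (by
      intro x
      have h1 := (mdifferentiableAt_scal h x).hasMFDerivAt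
      have h2 := ((mdifferentiableAt_normSq_torsionForm h x).hasMFDerivAt).const_smul k
      refine (h1.add h2).congr_mfderiv ?_
      ext v
      change mvfderiv (𝓡 n) (scal nabla) x v
        + k * mvfderiv (𝓡 n) (normSq (torsionForm nabla)) x v = 0
      rw [hk]
      ring)
  refine ⟨C, fun x => ?_⟩
  have := hC x
  simp only [Pi.add_apply, Pi.smul_apply, smul_eq_mul] at this
  linarith

end Conclusion

end SkewTorsion

/-! ### The theorem -/

theorem mainTheorem4 (n : ℕ) {M : Type*} [TopologicalSpace M] [T2Space M]
    [ChartedSpace (EuclideanSpace ℝ (Fin n)) M] [IsManifold (𝓡 n) ∞ M]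
    [Bundle.RiemannianBundle (fun x : M => TangentSpace (𝓡 n) x)]
    [IsContMDiffRiemannianBundle (𝓡 n) ∞ (EuclideanSpace ℝ (Fin n))
      (fun x : M => TangentSpace (𝓡 n) x)]
    (nabla nablaG : SkewTorsion.Connection n M)
    (hnabla : SkewTorsion.IsMetricWithSkewTorsion nabla)
    (hnablaG : SkewTorsion.IsLeviCivita nablaG)
    (T : Π x : M, TangentSpace (𝓡 n) x → TangentSpace (𝓡 n) x → TangentSpace (𝓡 n) x → ℝ)
    (hT : T = SkewTorsion.torsionForm nabla)
    (hE : SkewTorsion.IsNablaEinstein nabla) :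
    -- a)
    (∀ (x : M) (v : TangentSpace (𝓡 n) x),
      ((n : ℝ) - 2) / n * mvfderiv (𝓡 n) (SkewTorsion.scal nabla) x v
        - 1 / 2 * SkewTorsion.divergence₂ nablaG (SkewTorsion.tensorSq T) x v
        + 1 / 4 * mvfderiv (𝓡 n) (SkewTorsion.normSq T) x v = 0) ∧
    -- b)
    (PreconnectedSpace M → n ≠ 2 →
      ((∀ (x : M) (v : TangentSpace (𝓡 n) x),
          3 * SkewTorsion.smallTheta nablaG T x v + SkewTorsion.bigTheta T x v = 0) ∨
        SkewTorsion.IsHarmonic₃ nablaG T) →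
      (∃ C : ℝ, ∀ x : M,
        SkewTorsion.scal nabla x
            = -((n : ℝ) / (6 * ((n : ℝ) - 2))) * SkewTorsion.normSq T x + C ∧
          SkewTorsion.scal nablaG x
            = SkewTorsion.scal nabla x + 1 / 4 * SkewTorsion.normSq T x ∧
          SkewTorsion.scal nablaG x
            = ((n : ℝ) - 6) / (12 * ((n : ℝ) - 2)) * SkewTorsion.normSq T x + C) ∧
        ((∃ c : ℝ, ∀ x : M, SkewTorsion.scal nabla x = c) →
          ∃ c : ℝ, ∀ x : M, SkewTorsion.normSq T x = c)) ∧
    -- c)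
    (PreconnectedSpace M → n ≠ 2 → SkewTorsion.CurvaturePairSymmetric nabla →
      (∃ B : ℝ, ∀ x : M,
        SkewTorsion.scal nabla x
            = -((n : ℝ) / (2 * ((n : ℝ) - 2))) * SkewTorsion.normSq T x + B ∧
          SkewTorsion.scal nablaG x
            = -(((n : ℝ) + 2) / (4 * ((n : ℝ) - 2))) * SkewTorsion.normSq T x + B) ∧
        ((∃ c : ℝ, ∀ x : M, SkewTorsion.scal nabla x = c) →
          ∃ c : ℝ, ∀ x : M, SkewTorsion.normSq T x = c)) := by
  subst hT
  -- Dimension `0` is not excluded here. All traces are then empty sums, and the assertions hold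
  -- with every quantity and both constants equal to `0`.
  have hn0 : n = 0 → SkewTorsion.scal nabla = (fun _ => 0) ∧
      SkewTorsion.scal nablaG = (fun _ => 0) ∧
      SkewTorsion.normSq (SkewTorsion.torsionForm nabla) = fun _ => 0 := by
    rintro rfl
    exact ⟨by ext; simp [SkewTorsion.scal], by ext; simp [SkewTorsion.scal],
      by ext; simp [SkewTorsion.normSq]⟩
  have ha : ∀ (x : M) (v : TangentSpace (𝓡 n) x),
      ((n : ℝ) - 2) / n * mvfderiv (𝓡 n) (SkewTorsion.scal nabla) x v
        - 1 / 2 * SkewTorsion.divergence₂ nablaG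
          (SkewTorsion.tensorSq (SkewTorsion.torsionForm nabla)) x v
        + 1 / 4 * mvfderiv (𝓡 n) (SkewTorsion.normSq (SkewTorsion.torsionForm nabla)) x v = 0 := by
    intro x v
    by_cases hn : n = 0
    · obtain ⟨h1, -, h3⟩ := hn0 hn
      have h4 : SkewTorsion.divergence₂ nablaG
          (SkewTorsion.tensorSq (SkewTorsion.torsionForm nabla)) x v = 0 := by
        subst hn
        simp [SkewTorsion.divergence₂]
      rw [h1, h3, h4, mvfderiv_const]
      simp
    · exact hE.scal_identity hnabla hnablaG hn v
  have hconst : ∀ k : ℝ, k ≠ 0 →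
      (∃ C : ℝ, ∀ x : M, SkewTorsion.scal nabla x =
        -k * SkewTorsion.normSq (SkewTorsion.torsionForm nabla) x + C) →
      (∃ c : ℝ, ∀ x : M, SkewTorsion.scal nabla x = c) →
        ∃ c : ℝ, ∀ x : M, SkewTorsion.normSq (SkewTorsion.torsionForm nabla) x = c := by
    rintro k hk ⟨C, hC⟩ ⟨c, hc⟩
    refine ⟨(C - c) / k, fun x => ?_⟩
    rw [eq_div_iff hk]
    linarith [hC x, hc x]
  have hG := SkewTorsion.scal_leviCivita hnabla hnablaG
  refine ⟨ha, fun hM hn2 hθ => ?_, fun hM hn2 hR => ?_⟩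
  · by_cases hn : n = 0
    · obtain ⟨h1, h2, h3⟩ := hn0 hn
      rw [h1, h2, h3]
      exact ⟨⟨0, fun x => by simp⟩, fun _ => ⟨0, fun x => rfl⟩⟩
    have hn' : (n : ℝ) ≠ 0 := by exact_mod_cast hn
    have hn2' : (n : ℝ) - 2 ≠ 0 := sub_ne_zero.2 (by exact_mod_cast hn2)
    have hθ' : ∀ (x : M) (v : TangentSpace (𝓡 n) x),
        3 * SkewTorsion.smallTheta nablaG (SkewTorsion.torsionForm nabla) x v
          + SkewTorsion.bigTheta (SkewTorsion.torsionForm nabla) x v = 0 := by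
      rcases hθ with hθ | ⟨hd, hδ⟩
      · exact hθ
      · intro x v
        simp [SkewTorsion.smallTheta, SkewTorsion.bigTheta, hd, hδ]
    have hex := SkewTorsion.exists_scal_eq hnabla (k := (n : ℝ) / (6 * ((n : ℝ) - 2))) (by
      intro x v
      have h1 := ha x v
      rw [SkewTorsion.divergence_tensorSq hnabla hnablaG] at h1
      have h2 := hθ' x v
      -- The `θ` and `Θ` terms enter as `(3θ + Θ)/6 = 0`, and the coefficient of `d‖T‖²` is `1/4 -
      -- (1/2)(1/6) = 1/6`.
      have h3 : ((n : ℝ) - 2) / n * mvfderiv (𝓡 n) (SkewTorsion.scal nabla) x v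
          + 1 / 6 * mvfderiv (𝓡 n) (SkewTorsion.normSq (SkewTorsion.torsionForm nabla)) x v = 0 := by
        linarith
      field_simp at h3 ⊢
      linarith)
    refine ⟨?_, hconst _ (div_ne_zero hn' (mul_ne_zero (by norm_num) hn2')) hex⟩
    obtain ⟨C, hC⟩ := hex
    refine ⟨C, fun x => ⟨hC x, hG x, ?_⟩⟩
    rw [hG x, hC x]
    field_simp
    ring
  · by_cases hn : n = 0
    · obtain ⟨h1, h2, h3⟩ := hn0 hn
      rw [h1, h2, h3]
      exact ⟨⟨0, fun x => by simp⟩, fun _ => ⟨0, fun x => rfl⟩⟩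
    have hn' : (n : ℝ) ≠ 0 := by exact_mod_cast hn
    have hn2' : (n : ℝ) - 2 ≠ 0 := sub_ne_zero.2 (by exact_mod_cast hn2)
    have hex := SkewTorsion.exists_scal_eq hnabla (k := (n : ℝ) / (2 * ((n : ℝ) - 2))) (by
      intro x v
      have h1 := ha x v
      rw [SkewTorsion.divergence_tensorSq_of_pairSymmetric hnabla hnablaG hR] at h1
      -- Here the coefficient of `d‖T‖²` is `1/4 + (1/2)(1/2) = 1/2`.
      have h3 : ((n : ℝ) - 2) / n * mvfderiv (𝓡 n) (SkewTorsion.scal nabla) x v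
          + 1 / 2 * mvfderiv (𝓡 n) (SkewTorsion.normSq (SkewTorsion.torsionForm nabla)) x v = 0 := by
        linarith
      field_simp at h3 ⊢
      linarith)
    refine ⟨?_, hconst _ (div_ne_zero hn' (mul_ne_zero (by norm_num) hn2')) hex⟩
    obtain ⟨B, hB⟩ := hex
    refine ⟨B, fun x => ⟨hB x, ?_⟩⟩
    rw [hG x, hB x]
    field_simp
    ring
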